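/- Let $\Phi=\{\Phi(t)\}_{t\in\mathbb{R}}$ be a real-valued, (jointly) measurable, mean-square continuous, stationary Gaussian process whose covariance function has an integrable spectral density $p:\mathbb{R}\to(0,\infty)$, i.e. $\mathrm{Cov}(\Phi(t),\Phi(0))=\int_{\mathbb{R}}e^{it\lambda}p(\lambda)\,d\lambda$ for all $t\in\mathbb{R}$; the mean of $\Phi$ is an arbitrary constant. Let $\psi\in L^1(\mathbb{R})\cap L^2(\mathbb{R})$ be a complex-valued analytic wavelet, i.e. $\widehat\psi(\omega)=\int_{\mathbb{R}}e^{-it\omega}\psi(t)\,dt=0$ for all $\omega\le 0$. For $t\in\mathbb{R}$ and $s>0$ let $$W_\Phi(t,s)=\int_{\mathbb{R}}\Phi(\tau)\,\frac1s\,\overline{\psi\Big(\frac{\tau-t}{s}\Big)}\,d\tau,\qquad S_\Phi(t,s)=|W_\Phi(t,s)|^2,$$ where, for each $t$ and $s$, the integral converges absolutely almost surely, and write $W^R_\Phi=\mathrm{Re}\,W_\Phi$, $W^I_\Phi=\mathrm{Im}\,W_\Phi$. Then: (a) For any $t\in\mathbb{R}$, $d\in\mathbb{N}$ and $s_1,\dots,s_d>0$,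 the random vector $\mathbf{W}=(W_\Phi(t,s_1),\dots,W_\Phi(t,s_d))^\top$ is a complex Gaussian vector (its real and imaginary parts are jointly Gaussian) and is circularly symmetric: $e^{i\theta}\mathbf{W}$ has the same distribution as $\mathbf{W}$ for every $\theta\in\mathbb{R}$. (b) Suppose in addition that $\psi$ is not almost everywhere zero. For any $t\in\mathbb{R}$ and $s_1,s_2>0$ with $s_1\ne s_2$, the number $d_{W_\Phi}(s_1,s_2)=\{\mathbb{E}[|W_\Phi(0,s_1)-W_\Phi(0,s_2)|^2]\}^{1/2}$ is positive and $$\frac{|W_\Phi(t,s_1)-W_\Phi(t,s_2)|^2}{d_{W_\Phi}(s_1,s_2)^2}$$ follows the exponential distribution with mean one. (c) For any $t\in\mathbb{R}$ and $s_1,s_2>0$, $$\mathrm{Cov}\big(S_\Phi(t,s_1),S_\Phi(t,s_2)\big)=4\big\{\mathbb{E}[W^R_\Phi(t,s_1)W^R_\Phi(t,s_2)]\big\}^2+4\big\{\mathbb{E}[W^R_\Phi(t,s_1)W^I_\Phi(t,s_2)]\big\}^2\ge 0 .$$ In particular, for any $s>0$, $$\mathrm{Var}\big(S_\Phi(t,s)\big)=4\big\{\mathbb{E}[|W^R_\Phi(t,s)|^2]\big\}^2=\big\{\mathbb{E}[S_\Phi(t,s)]\big\}^2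 .$$ -/

import Mathlib

open MeasureTheory ProbabilityTheory Filter Topology
open scoped ComplexConjugate

noncomputable section

/-- The Fourier transform with the angular-frequency convention, `∫ e^{-i t ω} ψ(t) dt`. -/
def angularFourier (ψ : ℝ → ℂ) (ω : ℝ) : ℂ :=
  ∫ t : ℝ, Complex.exp (-(Complex.I * t * ω)) * ψ t

/-- A mother wavelet `ψ ∈ L¹ ∩ L²` whose Fourier transform vanishes on `(-∞, 0]`. -/
structure IsAnalyticWavelet (ψ : ℝ → ℂ) : Prop where
  integrable : Integrable ψ
  memLp_two : MemLp ψ 2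
  analytic : ∀ ω : ℝ, ω ≤ 0 → angularFourier ψ ω = 0

/-- The integrand of the wavelet transform of the signal `f` at time `t` and scale `s`. -/
def waveletIntegrand (ψ : ℝ → ℂ) (f : ℝ → ℝ) (t s τ : ℝ) : ℂ :=
  (f τ : ℂ) * (((1 / s : ℝ) : ℂ) * conj (ψ ((τ - t) / s)))

/-- The wavelet transform of the signal `f` at time `t` and scale `s`. -/
def waveletTransform (ψ : ℝ → ℂ) (f : ℝ → ℝ) (t s : ℝ) : ℂ :=
  ∫ τ : ℝ, waveletIntegrand ψ f t s τ

section Noise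

variable {Ω : Type*} [MeasurableSpace Ω]

/-- Strict stationarity: the law of the process is invariant under time shifts. -/
def IsStationaryProcess (Φ : ℝ → Ω → ℝ) (P : Measure Ω) : Prop :=
  ∀ h : ℝ, IdentDistrib (fun ω t ↦ Φ (t + h) ω) (fun ω t ↦ Φ t ω) P P

/-- Mean-square continuity: `E|Φ(u) - Φ(t)|² → 0` as `u → t`. -/
def IsMeanSquareContinuous (Φ : ℝ → Ω → ℝ) (P : Measure Ω) : Prop :=
  ∀ t : ℝ, Tendsto (fun u ↦ ∫ ω, (Φ u ω - Φ t ω) ^ 2 ∂P) (𝓝 t) (𝓝 0)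

/-- A real, (jointly) measurable, mean-square continuous, stationary Gaussian process whose
covariance function has the strictly positive spectral density `p`. The mean is arbitrary. -/
structure IsStationaryGaussianNoise (Φ : ℝ → Ω → ℝ) (P : Measure Ω) (p : ℝ → ℝ) : Prop where
  measurable : Measurable (Function.uncurry Φ)
  gaussian : IsGaussianProcess Φ P
  stationary : IsStationaryProcess Φ P
  meanSquareContinuous : IsMeanSquareContinuous Φ P
  density_pos : ∀ ξ : ℝ, 0 < p ξ
  density_integrable : Integrable p
  covariance_eq : ∀ t : ℝ, ((cov[Φ t, Φ 0; P] : ℝ) : ℂ) =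
    ∫ ξ : ℝ, Complex.exp (Complex.I * t * ξ) * (p ξ : ℂ)

/-- The wavelet transform `W_Φ(t, s)` of a random process, taken path by path. -/
def noiseAWT (ψ : ℝ → ℂ) (Φ : ℝ → Ω → ℝ) (t s : ℝ) (ω : Ω) : ℂ :=
  waveletTransform ψ (fun τ ↦ Φ τ ω) t s

/-- The scalogram `S_Φ(t, s) = |W_Φ(t, s)|²`. -/
def noiseScalogram (ψ : ℝ → ℂ) (Φ : ℝ → Ω → ℝ) (t s : ℝ) (ω : Ω) : ℝ :=
  ‖noiseAWT ψ Φ t s ω‖ ^ 2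

/-- The canonical distance `(E|W_Φ(0, s₁) - W_Φ(0, s₂)|²)^{1/2}`. -/
def canonicalDist (ψ : ℝ → ℂ) (Φ : ℝ → Ω → ℝ) (P : Measure Ω) (s₁ s₂ : ℝ) : ℝ :=
  Real.sqrt (∫ ω, ‖noiseAWT ψ Φ 0 s₁ ω - noiseAWT ψ Φ 0 s₂ ω‖ ^ 2 ∂P)

/-- Circular symmetry of a complex random vector: `e^{iθ} X` has the law of `X` for every real
`θ`. -/
def IsCircularlySymmetric {d : ℕ} (X : Ω → Fin d → ℂ) (P : Measure Ω) : Prop :=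
  ∀ θ : ℝ, IdentDistrib (fun ω ↦ Complex.exp (Complex.I * θ) • X ω) X P P

end Noise

end

open scoped ENNReal NNReal

/-
An analytic wavelet has no negative frequencies, so for two of the kernels `f`, `g` which `W_Φ`
integrates against, the functions `ξ ↦ f̂(-ξ)` and `ĝ` have disjoint supports. The spectral
representation `E[∫ Φ f · ∫ Φ g] = ∫ f̂(-ξ) ĝ(ξ) dν(ξ)` then says that the wavelet coefficients have
vanishing pseudo-covariance: they are proper, hence circularly symmetric, complex Gaussians. Joint
Gaussianity holds because a square-integrable variable lying in the closed linear span of a Gaussian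
process is Gaussian. The exponential law and the covariance identity are facts about proper complex
Gaussians; the canonical distance is positive because it vanishes only if `ψ̂` is invariant under a
nontrivial dilation, which by continuity at `0` forces `ψ̂ = 0`.
-/

section GaussianMoments

open Polynomial in
lemma iteratedDeriv_exp_mul_sq_div_two (v : ℝ) (n : ℕ) :
    iteratedDeriv n (fun t : ℝ ↦ Real.exp (v * t ^ 2 / 2)) = fun t ↦
      ((fun q : ℝ[X] ↦ derivative q + C v * X * q)^[n] 1).eval t * Real.exp (v * t ^ 2 / 2) := by
  induction n with
  | zero => simp
  | succ n ih =>
    rw [iteratedDeriv_succ, ih, Function.iterate_succ_apply']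
    funext t
    have hexp := (((hasDerivAt_pow 2 t).const_mul v).div_const 2).exp
    refine ((Polynomial.hasDerivAt _ t).fun_mul hexp).deriv.trans ?_
    simp only [eval_add, eval_mul, eval_C, eval_X]
    push_cast
    ring

lemma integral_pow_four_gaussianReal (v : ℝ≥0) :
    ∫ x, x ^ 4 ∂gaussianReal 0 v = 3 * (v : ℝ) ^ 2 := by
  have hmgf : iteratedDeriv 4 (mgf (fun x ↦ x) (gaussianReal 0 v)) 0 =
      ∫ x, x ^ 4 ∂gaussianReal 0 v := by
    rw [iteratedDeriv_mgf_zero] <;> simp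
  rw [← hmgf, mgf_fun_id_gaussianReal]
  simp only [zero_mul, zero_add, iteratedDeriv_exp_mul_sq_div_two, Function.iterate_succ_apply',
    Function.iterate_zero_apply]
  simp
  ring

variable {Ω : Type*} [MeasurableSpace Ω] {P : Measure Ω} {X Y : Ω → ℝ}

lemma integral_pow_four_of_hasGaussianLaw (hX : HasGaussianLaw X P) (hX₀ : ∫ ω, X ω ∂P = 0) :
    ∫ ω, X ω ^ 4 ∂P = 3 * (∫ ω, X ω ^ 2 ∂P) ^ 2 := by
  have hlaw : P.map X = gaussianReal 0 (∫ ω, X ω ^ 2 ∂P).toNNReal := by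
    rw [hX.map_eq_gaussianReal, hX₀, variance_of_integral_eq_zero hX.aemeasurable hX₀]
  rw [← integral_map (f := fun x ↦ x ^ 4) hX.aemeasurable (by fun_prop), hlaw,
    integral_pow_four_gaussianReal, Real.coe_toNNReal _ (by positivity)]

lemma integrable_pow_of_hasGaussianLaw (hX : HasGaussianLaw X P) (n : ℕ) :
    Integrable (fun ω ↦ X ω ^ n) P := by
  have := hX.isProbabilityMeasure
  have hnorm := (hX.memLp (p := n) (by simp)).integrable_norm_pow'
  exact hnorm.mono (hX.aemeasurable.pow_const n).aestronglyMeasurable (ae_of_all _ fun ω ↦ by simp)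

lemma memLp_two_sq_of_hasGaussianLaw (hX : HasGaussianLaw X P) :
    MemLp (fun ω ↦ X ω ^ 2) 2 P := by
  rw [memLp_two_iff_integrable_sq (hX.aemeasurable.pow_const 2).aestronglyMeasurable]
  simpa only [← pow_mul] using integrable_pow_of_hasGaussianLaw hX 4

lemma hasGaussianLaw_add_const_mul (hXY : HasGaussianLaw (fun ω ↦ (X ω, Y ω)) P) (c : ℝ) :
    HasGaussianLaw (fun ω ↦ X ω + c * Y ω) P :=
  hXY.map_fun (ContinuousLinearMap.fst ℝ ℝ ℝ + c • ContinuousLinearMap.snd ℝ ℝ ℝ)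

lemma integral_add_const_mul_sq (hX : MemLp X 2 P) (hY : MemLp Y 2 P) (c : ℝ) :
    ∫ ω, (X ω + c * Y ω) ^ 2 ∂P =
      ∫ ω, X ω ^ 2 ∂P + 2 * c * ∫ ω, X ω * Y ω ∂P + c ^ 2 * ∫ ω, Y ω ^ 2 ∂P := by
  have hXY : Integrable (fun ω ↦ 2 * c * (X ω * Y ω)) P := (hX.integrable_mul hY).const_mul _
  rw [← integral_const_mul, ← integral_const_mul, ← integral_add hX.integrable_sq hXY,
    ← integral_add (hX.integrable_sq.fun_add hXY) (hY.integrable_sq.const_mul _)]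
  exact integral_congr_ae (ae_of_all _ fun ω ↦ by ring)

lemma integral_add_const_mul_pow_four_of_hasGaussianLaw
    (hXY : HasGaussianLaw (fun ω ↦ (X ω, Y ω)) P)
    (hX₀ : ∫ ω, X ω ∂P = 0) (hY₀ : ∫ ω, Y ω ∂P = 0) (c : ℝ) :
    ∫ ω, (X ω + c * Y ω) ^ 4 ∂P =
      3 * (∫ ω, X ω ^ 2 ∂P + 2 * c * ∫ ω, X ω * Y ω ∂P + c ^ 2 * ∫ ω, Y ω ^ 2 ∂P) ^ 2 := by
  have hmean : ∫ ω, X ω + c * Y ω ∂P = 0 := by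
    rw [integral_add hXY.fst.integrable (hXY.snd.integrable.const_mul c), integral_const_mul, hX₀,
      hY₀]
    simp
  rw [integral_pow_four_of_hasGaussianLaw (hasGaussianLaw_add_const_mul hXY c) hmean,
    integral_add_const_mul_sq hXY.fst.memLp_two hXY.snd.memLp_two]

lemma integral_sq_mul_sq_of_hasGaussianLaw (hXY : HasGaussianLaw (fun ω ↦ (X ω, Y ω)) P)
    (hX₀ : ∫ ω, X ω ∂P = 0) (hY₀ : ∫ ω, Y ω ∂P = 0) :
    ∫ ω, X ω ^ 2 * Y ω ^ 2 ∂P =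
      (∫ ω, X ω ^ 2 ∂P) * (∫ ω, Y ω ^ 2 ∂P) + 2 * (∫ ω, X ω * Y ω ∂P) ^ 2 := by
  have hX := integrable_pow_of_hasGaussianLaw hXY.fst 4
  have hY := integrable_pow_of_hasGaussianLaw hXY.snd 4
  have hXcY (c : ℝ) : Integrable (fun ω ↦ (X ω + c * Y ω) ^ 4) P :=
    integrable_pow_of_hasGaussianLaw (hasGaussianLaw_add_const_mul hXY c) 4
  have hsum := (hXcY 1).fun_add (hXcY (-1))
  have polarization (ω : Ω) : X ω ^ 2 * Y ω ^ 2 =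
      ((X ω + 1 * Y ω) ^ 4 + (X ω + (-1) * Y ω) ^ 4 - 2 * X ω ^ 4 - 2 * Y ω ^ 4) / 12 := by
    ring
  simp_rw [polarization]
  rw [integral_div, integral_sub (hsum.sub' (hX.const_mul 2)) (hY.const_mul 2),
    integral_sub hsum (hX.const_mul 2), integral_add (hXcY 1) (hXcY (-1)),
    integral_add_const_mul_pow_four_of_hasGaussianLaw hXY hX₀ hY₀,
    integral_add_const_mul_pow_four_of_hasGaussianLaw hXY hX₀ hY₀,
    integral_const_mul, integral_const_mul, integral_pow_four_of_hasGaussianLaw hXY.fst hX₀,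
    integral_pow_four_of_hasGaussianLaw hXY.snd hY₀]
  ring

lemma covariance_sq_sq_of_hasGaussianLaw (hXY : HasGaussianLaw (fun ω ↦ (X ω, Y ω)) P)
    (hX₀ : ∫ ω, X ω ∂P = 0) (hY₀ : ∫ ω, Y ω ∂P = 0) :
    cov[fun ω ↦ X ω ^ 2, fun ω ↦ Y ω ^ 2; P] = 2 * (∫ ω, X ω * Y ω ∂P) ^ 2 := by
  have := hXY.isProbabilityMeasure
  rw [covariance_eq_sub (memLp_two_sq_of_hasGaussianLaw hXY.fst)
    (memLp_two_sq_of_hasGaussianLaw hXY.snd)]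
  simp only [Pi.mul_apply]
  rw [integral_sq_mul_sq_of_hasGaussianLaw hXY hX₀ hY₀]
  ring

end GaussianMoments

section ProperGaussian

variable {Ω : Type*} [MeasurableSpace Ω] {P : Measure Ω}

lemma re_integral_mul {Z W : Ω → ℂ} (hZ : MemLp Z 2 P) (hW : MemLp W 2 P) :
    (∫ ω, Z ω * W ω ∂P).re =
      ∫ ω, (Z ω).re * (W ω).re ∂P - ∫ ω, (Z ω).im * (W ω).im ∂P :=
  (integral_re (hZ.integrable_mul hW)).symm.trans
    (integral_sub (hZ.re.integrable_mul hW.re) (hZ.im.integrable_mul hW.im))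

lemma im_integral_mul {Z W : Ω → ℂ} (hZ : MemLp Z 2 P) (hW : MemLp W 2 P) :
    (∫ ω, Z ω * W ω ∂P).im =
      ∫ ω, (Z ω).re * (W ω).im ∂P + ∫ ω, (Z ω).im * (W ω).re ∂P :=
  (integral_im (hZ.integrable_mul hW)).symm.trans
    (integral_add (hZ.re.integrable_mul hW.im) (hZ.im.integrable_mul hW.re))

lemma integral_sq_norm_eq_integral_re_sq_add_integral_im_sq {Z : Ω → ℂ} (hZ : MemLp Z 2 P) :
    ∫ ω, ‖Z ω‖ ^ 2 ∂P = ∫ ω, (Z ω).re ^ 2 ∂P + ∫ ω, (Z ω).im ^ 2 ∂P := by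
  simp only [Complex.sq_norm, Complex.normSq_apply, ← sq]
  exact integral_add hZ.re.integrable_sq hZ.im.integrable_sq

variable {E F : Type*} [NormedAddCommGroup E] [NormedSpace ℝ E] [NormedSpace ℂ E]
  [MeasurableSpace E]
  [NormedAddCommGroup F] [NormedSpace ℝ F] [NormedSpace ℂ F]
  [MeasurableSpace F]

/-- A proper complex Gaussian random vector: a centred Gaussian vector whose pseudo-covariance
`(M, N) ↦ E[M(Z) N(Z)]` vanishes. Only the diagonal of this symmetric bilinear form is recorded;
the rest follows by polarization. -/
structure IsProperGaussian (Z : Ω → E) (P : Measure Ω) : Prop where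
  hasGaussianLaw : HasGaussianLaw Z P
  integral_dual_eq_zero (M : StrongDual ℂ E) : ∫ ω, M (Z ω) ∂P = 0
  integral_dual_sq_eq_zero (M : StrongDual ℂ E) : ∫ ω, M (Z ω) ^ 2 ∂P = 0

namespace IsProperGaussian

variable [IsScalarTower ℝ ℂ E] [IsScalarTower ℝ ℂ F] [BorelSpace E] [BorelSpace F]

lemma map {Z : Ω → E} (hZ : IsProperGaussian Z P) (T : E →L[ℂ] F) :
    IsProperGaussian (fun ω ↦ T (Z ω)) P where
  hasGaussianLaw := hZ.hasGaussianLaw.map_fun (T.restrictScalars ℝ)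
  integral_dual_eq_zero M := hZ.integral_dual_eq_zero (M.comp T)
  integral_dual_sq_eq_zero M := hZ.integral_dual_sq_eq_zero (M.comp T)

lemma integral_eq_zero {Z : Ω → ℂ} (hZ : IsProperGaussian Z P) : ∫ ω, Z ω ∂P = 0 :=
  hZ.integral_dual_eq_zero (.id ℂ ℂ)

lemma integral_sq_eq_zero {Z : Ω → ℂ} (hZ : IsProperGaussian Z P) : ∫ ω, Z ω ^ 2 ∂P = 0 :=
  hZ.integral_dual_sq_eq_zero (.id ℂ ℂ)

lemma memLp_two {Z : Ω → ℂ} (hZ : IsProperGaussian Z P) : MemLp Z 2 P :=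
  hZ.hasGaussianLaw.memLp_two

lemma integral_re_eq_zero {Z : Ω → ℂ} (hZ : IsProperGaussian Z P) : ∫ ω, (Z ω).re ∂P = 0 := by
  have := integral_re hZ.hasGaussianLaw.integrable
  rwa [hZ.integral_eq_zero] at this

lemma integral_im_eq_zero {Z : Ω → ℂ} (hZ : IsProperGaussian Z P) : ∫ ω, (Z ω).im ∂P = 0 := by
  have := integral_im hZ.hasGaussianLaw.integrable
  rwa [hZ.integral_eq_zero] at this

lemma integral_re_mul_im_eq_zero {Z : Ω → ℂ} (hZ : IsProperGaussian Z P) :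
    ∫ ω, (Z ω).re * (Z ω).im ∂P = 0 := by
  have h := im_integral_mul hZ.memLp_two hZ.memLp_two
  simp only [← sq, hZ.integral_sq_eq_zero, Complex.zero_im, mul_comm (Complex.im _)] at h
  linarith

lemma integral_re_sq {Z : Ω → ℂ} (hZ : IsProperGaussian Z P) :
    ∫ ω, (Z ω).re ^ 2 ∂P = (∫ ω, ‖Z ω‖ ^ 2 ∂P) / 2 := by
  have h := re_integral_mul hZ.memLp_two hZ.memLp_two
  simp only [← sq, hZ.integral_sq_eq_zero, Complex.zero_re] at h
  linarith [integral_sq_norm_eq_integral_re_sq_add_integral_im_sq hZ.memLp_two]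

lemma integral_im_sq {Z : Ω → ℂ} (hZ : IsProperGaussian Z P) :
    ∫ ω, (Z ω).im ^ 2 ∂P = (∫ ω, ‖Z ω‖ ^ 2 ∂P) / 2 := by
  linarith [hZ.integral_re_sq, integral_sq_norm_eq_integral_re_sq_add_integral_im_sq hZ.memLp_two]

section CircularSymmetry

variable {Z : Ω → E}

lemma charFunDual_map (hZ : IsProperGaussian Z P) (L : StrongDual ℝ E) :
    charFunDual (P.map Z) L =
      Complex.exp (-((∫ ω, ‖(L.extendRCLike : StrongDual ℂ E) (Z ω)‖ ^ 2 ∂P : ℝ) : ℂ) / 4) := by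
  set M : StrongDual ℂ E := L.extendRCLike
  have hMZ := hZ.map M
  have hL (ω : Ω) : L (Z ω) = (M (Z ω)).re :=
    (StrongDual.re_extendRCLike_apply (𝕜 := ℂ) L (Z ω)).symm
  have hmeas : AEMeasurable (fun ω ↦ (M (Z ω)).re) P :=
    hMZ.hasGaussianLaw.aemeasurable.re
  rw [hZ.hasGaussianLaw.charFunDual_map_eq_fun]
  simp only [hL]
  rw [variance_of_integral_eq_zero hmeas hMZ.integral_re_eq_zero, hMZ.integral_re_eq_zero,
    hMZ.integral_re_sq]
  congr 1
  push_cast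
  ring

theorem identDistrib_smul [CompleteSpace E] [SecondCountableTopology E]
    (hZ : IsProperGaussian Z P) {c : ℂ} (hc : ‖c‖ = 1) :
    IdentDistrib (fun ω ↦ c • Z ω) Z P P := by
  have := hZ.hasGaussianLaw.isProbabilityMeasure
  have hcZ : IsProperGaussian (fun ω ↦ c • Z ω) P := hZ.map (c • .id ℂ E)
  have hm := hcZ.hasGaussianLaw.aemeasurable
  have hm' := hZ.hasGaussianLaw.aemeasurable
  refine ⟨hm, hm', Measure.ext_of_charFunDual (funext fun L ↦ ?_)⟩
  rw [hcZ.charFunDual_map, hZ.charFunDual_map]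
  simp only [map_smul, norm_smul, hc, one_mul]

end CircularSymmetry

lemma integral_dual_mul_dual_eq_zero {Z : Ω → E} (hZ : IsProperGaussian Z P)
    (M N : StrongDual ℂ E) : ∫ ω, M (Z ω) * N (Z ω) ∂P = 0 := by
  have hsq (K : StrongDual ℂ E) : Integrable (fun ω ↦ K (Z ω) ^ 2) P := by
    simpa only [sq, Pi.mul_def] using (hZ.map K).memLp_two.integrable_mul (hZ.map K).memLp_two
  have polarization (ω : Ω) : M (Z ω) * N (Z ω) =
      ((M + N) (Z ω) ^ 2 - M (Z ω) ^ 2 - N (Z ω) ^ 2) / 2 := by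
    simp only [add_apply]
    ring
  simp_rw [polarization]
  rw [integral_div, integral_sub ((hsq _).sub' (hsq _)) (hsq _), integral_sub (hsq _) (hsq _)]
  simp only [hZ.integral_dual_sq_eq_zero, sub_zero, zero_div]

end IsProperGaussian
end ProperGaussian

section ExponentialLaw

lemma charFun_expMeasure {r : ℝ} (hr : 0 < r) (t : ℝ) :
    charFun (expMeasure r) t = r / (r - t * Complex.I) := by
  have hpdf (x : ℝ) : (gammaPDF 1 r x).toReal • Complex.exp (t * x * Complex.I) =
      (Set.Ici (0 : ℝ)).indicator (fun x : ℝ ↦ r * Complex.exp ((t * Complex.I - r) * x)) x := by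
    rcases le_or_gt 0 x with hx | hx
    · rw [Set.indicator_of_mem (Set.mem_Ici.2 hx), gammaPDF_of_nonneg hx,
        ENNReal.toReal_ofReal (by simp only [Real.Gamma_one]; positivity)]
      simp only [Real.Gamma_one, Real.rpow_one, sub_self, Real.rpow_zero, Complex.real_smul,
        div_one, mul_one]
      push_cast
      rw [mul_assoc, ← Complex.exp_add]
      ring_nf
    · rw [Set.indicator_of_notMem (Set.notMem_Ici.2 hx), gammaPDF_of_neg hx]
      simp
  rw [charFun_apply_real, expMeasure, gammaMeasure, integral_withDensity_eq_integral_toReal_smul₀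
    (f := gammaPDF 1 r) (measurable_gammaPDFReal 1 r).ennreal_ofReal.aemeasurable
    (ae_of_all _ fun x ↦ ENNReal.ofReal_lt_top)]
  simp_rw [hpdf]
  rw [integral_indicator measurableSet_Ici, integral_Ici_eq_integral_Ioi, integral_const_mul,
    integral_exp_mul_complex_Ioi (by simpa using hr), ← neg_sub (r : ℂ)]
  simp [div_eq_mul_inv, neg_inv]

lemma integral_cexp_sq_gaussianReal (v : ℝ≥0) (t : ℝ) :
    (∫ x, Complex.exp (((t * x ^ 2 : ℝ) : ℂ) * Complex.I) ∂gaussianReal 0 v) ^ 2 =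
      1 / (1 - 2 * v * t * Complex.I) := by
  rcases eq_or_ne v 0 with rfl | hv
  · simp
  have hvc : (v : ℂ) ≠ 0 := mod_cast hv
  have hπ : (Real.pi : ℂ) ≠ 0 := mod_cast Real.pi_ne_zero
  set b : ℂ := 1 / (2 * v) - t * Complex.I with hb
  have hb_re : 0 < b.re := by
    have : b.re = 1 / (2 * v) := by simp [hb, ← NNReal.coe_inv]
    rw [this]
    positivity
  have hb₀ : b ≠ 0 := fun h ↦ by simp [h] at hb_re
  have hgauss : ∫ x, Complex.exp (((t * x ^ 2 : ℝ) : ℂ) * Complex.I) ∂gaussianReal 0 v =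
      ((√(2 * Real.pi * v))⁻¹ : ℝ) * ∫ x : ℝ, Complex.exp (-b * x ^ 2) := by
    rw [integral_gaussianReal_eq_integral_smul hv, ← integral_const_mul]
    refine integral_congr_ae (ae_of_all _ fun x ↦ ?_)
    simp only [gaussianPDFReal, Complex.real_smul, sub_zero]
    rw [Complex.ofReal_mul, mul_assoc, Complex.ofReal_exp, ← Complex.exp_add]
    congr 2
    rw [hb]
    push_cast
    field_simp
    ring
  have hcpow : ((Real.pi / b : ℂ) ^ (1 / 2 : ℂ)) ^ 2 = Real.pi / b := by
    rw [← Complex.cpow_nat_mul]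
    norm_num
  rw [hgauss, integral_gaussian_complex hb_re, mul_pow, hcpow, ← Complex.ofReal_pow, inv_pow,
    Real.sq_sqrt (by positivity)]
  have hden : 1 - 2 * v * t * Complex.I = 2 * v * b := by
    rw [hb]
    field_simp
  rw [hden]
  push_cast
  field_simp

end ExponentialLaw

section ProperGaussian

variable {Ω : Type*} [MeasurableSpace Ω] {P : Measure Ω}

namespace IsProperGaussian

variable {Z : Ω → ℂ}

lemma indepFun_re_im (hZ : IsProperGaussian Z P) :
    IndepFun (fun ω ↦ (Z ω).re) (fun ω ↦ (Z ω).im) P := by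
  have := hZ.hasGaussianLaw.isProbabilityMeasure
  have hre_im : HasGaussianLaw (fun ω ↦ ((Z ω).re, (Z ω).im)) P :=
    hZ.hasGaussianLaw.map_fun (Complex.reCLM.prod Complex.imCLM)
  refine hre_im.indepFun_of_covariance_eq_zero ?_
  rw [covariance_eq_sub hre_im.fst.memLp_two hre_im.snd.memLp_two, hZ.integral_re_eq_zero, zero_mul,
    sub_zero]
  exact hZ.integral_re_mul_im_eq_zero

lemma map_re (hZ : IsProperGaussian Z P) :
    P.map (fun ω ↦ (Z ω).re) = gaussianReal 0 ((∫ ω, ‖Z ω‖ ^ 2 ∂P) / 2).toNNReal := by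
  have hre : HasGaussianLaw (fun ω ↦ (Z ω).re) P := hZ.hasGaussianLaw.map_fun Complex.reCLM
  rw [hre.map_eq_gaussianReal, variance_of_integral_eq_zero hre.aemeasurable hZ.integral_re_eq_zero,
    hZ.integral_re_eq_zero, hZ.integral_re_sq]

lemma map_im (hZ : IsProperGaussian Z P) :
    P.map (fun ω ↦ (Z ω).im) = gaussianReal 0 ((∫ ω, ‖Z ω‖ ^ 2 ∂P) / 2).toNNReal := by
  have him : HasGaussianLaw (fun ω ↦ (Z ω).im) P := hZ.hasGaussianLaw.map_fun Complex.imCLM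
  rw [him.map_eq_gaussianReal, variance_of_integral_eq_zero him.aemeasurable hZ.integral_im_eq_zero,
    hZ.integral_im_eq_zero, hZ.integral_im_sq]

lemma integral_cexp_sq_norm (hZ : IsProperGaussian Z P) (t : ℝ) :
    ∫ ω, Complex.exp (((t * ‖Z ω‖ ^ 2 : ℝ) : ℂ) * Complex.I) ∂P =
      1 / (1 - (∫ ω, ‖Z ω‖ ^ 2 ∂P : ℝ) * t * Complex.I) := by
  let φ (x : ℝ) : ℂ := Complex.exp (((t * x ^ 2 : ℝ) : ℂ) * Complex.I)
  have hφ : Measurable φ := by fun_prop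
  have hre : AEMeasurable (fun ω ↦ (Z ω).re) P := hZ.hasGaussianLaw.aemeasurable.re
  have him : AEMeasurable (fun ω ↦ (Z ω).im) P := hZ.hasGaussianLaw.aemeasurable.im
  have hsplit (ω : Ω) :
      Complex.exp (((t * ‖Z ω‖ ^ 2 : ℝ) : ℂ) * Complex.I) = φ (Z ω).re * φ (Z ω).im := by
    rw [← Complex.exp_add, Complex.sq_norm, Complex.normSq_apply]
    push_cast
    ring_nf
  calc ∫ ω, Complex.exp (((t * ‖Z ω‖ ^ 2 : ℝ) : ℂ) * Complex.I) ∂P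
      = (∫ ω, φ (Z ω).re ∂P) * ∫ ω, φ (Z ω).im ∂P := by
        simp_rw [hsplit]
        exact (hZ.indepFun_re_im.comp hφ hφ).integral_fun_mul_eq_mul_integral
          (hφ.comp_aemeasurable hre).aestronglyMeasurable
          (hφ.comp_aemeasurable him).aestronglyMeasurable
    _ = (∫ x, φ x ∂gaussianReal 0 ((∫ ω, ‖Z ω‖ ^ 2 ∂P) / 2).toNNReal) ^ 2 := by
        rw [← integral_map hre hφ.aestronglyMeasurable, ← integral_map him hφ.aestronglyMeasurable,
          hZ.map_re, hZ.map_im, sq]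
    _ = 1 / (1 - (∫ ω, ‖Z ω‖ ^ 2 ∂P : ℝ) * t * Complex.I) := by
        rw [integral_cexp_sq_gaussianReal,
          Real.coe_toNNReal _ (div_nonneg (integral_nonneg fun _ ↦ by positivity) two_pos.le)]
        push_cast
        ring_nf

theorem hasLaw_sq_norm_div (hZ : IsProperGaussian Z P) (hpos : 0 < ∫ ω, ‖Z ω‖ ^ 2 ∂P) :
    HasLaw (fun ω ↦ ‖Z ω‖ ^ 2 / ∫ ω, ‖Z ω‖ ^ 2 ∂P) (expMeasure 1) P := by
  have := hZ.hasGaussianLaw.isProbabilityMeasure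
  have := isProbabilityMeasure_expMeasure (r := 1) one_pos
  set D := ∫ ω, ‖Z ω‖ ^ 2 ∂P with hD
  have hmeas : AEMeasurable (fun ω ↦ ‖Z ω‖ ^ 2 / D) P :=
    (hZ.hasGaussianLaw.aemeasurable.norm.pow_const 2).div_const D
  have hDc : (D : ℂ) ≠ 0 := mod_cast hpos.ne'
  refine ⟨hmeas, Measure.ext_of_charFun (funext fun t ↦ ?_)⟩
  calc charFun (P.map fun ω ↦ ‖Z ω‖ ^ 2 / D) t
      = ∫ ω, Complex.exp (((t / D * ‖Z ω‖ ^ 2 : ℝ) : ℂ) * Complex.I) ∂P := by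
        rw [charFun_apply_real, integral_map hmeas (by fun_prop)]
        refine integral_congr_ae (ae_of_all _ fun ω ↦ ?_)
        push_cast
        ring_nf
    _ = 1 / (1 - t * Complex.I) := by
        rw [hZ.integral_cexp_sq_norm, ← hD]
        push_cast
        field_simp
    _ = charFun (expMeasure 1) t := by simp [charFun_expMeasure]

section Pair

variable {W : Ω → ℂ}

lemma fst (hZW : IsProperGaussian (fun ω ↦ (Z ω, W ω)) P) : IsProperGaussian Z P :=
  hZW.map (.fst ℂ ℂ ℂ)

lemma snd (hZW : IsProperGaussian (fun ω ↦ (Z ω, W ω)) P) : IsProperGaussian W P :=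
  hZW.map (.snd ℂ ℂ ℂ)

lemma sub (hZW : IsProperGaussian (fun ω ↦ (Z ω, W ω)) P) :
    IsProperGaussian (fun ω ↦ Z ω - W ω) P :=
  hZW.map (ContinuousLinearMap.fst ℂ ℂ ℂ - ContinuousLinearMap.snd ℂ ℂ ℂ)

lemma integral_mul_eq_zero (hZW : IsProperGaussian (fun ω ↦ (Z ω, W ω)) P) :
    ∫ ω, Z ω * W ω ∂P = 0 :=
  hZW.integral_dual_mul_dual_eq_zero (.fst ℂ ℂ ℂ) (.snd ℂ ℂ ℂ)

lemma integral_im_mul_im (hZW : IsProperGaussian (fun ω ↦ (Z ω, W ω)) P) :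
    ∫ ω, (Z ω).im * (W ω).im ∂P = ∫ ω, (Z ω).re * (W ω).re ∂P := by
  have h := re_integral_mul hZW.fst.memLp_two hZW.snd.memLp_two
  rw [hZW.integral_mul_eq_zero, Complex.zero_re] at h
  linarith

lemma integral_im_mul_re (hZW : IsProperGaussian (fun ω ↦ (Z ω, W ω)) P) :
    ∫ ω, (Z ω).im * (W ω).re ∂P = -∫ ω, (Z ω).re * (W ω).im ∂P := by
  have h := im_integral_mul hZW.fst.memLp_two hZW.snd.memLp_two
  rw [hZW.integral_mul_eq_zero, Complex.zero_im] at h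
  linarith

theorem covariance_sq_norm (hZW : IsProperGaussian (fun ω ↦ (Z ω, W ω)) P) :
    cov[fun ω ↦ ‖Z ω‖ ^ 2, fun ω ↦ ‖W ω‖ ^ 2; P] =
      4 * (∫ ω, (Z ω).re * (W ω).re ∂P) ^ 2 + 4 * (∫ ω, (Z ω).re * (W ω).im ∂P) ^ 2 := by
  have := hZW.hasGaussianLaw.isProbabilityMeasure
  have hgauss (L M : ℂ →L[ℝ] ℝ) : HasGaussianLaw (fun ω ↦ (L (Z ω), M (W ω))) P :=
    hZW.hasGaussianLaw.map_fun (L.prodMap M)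
  have hre_re := hgauss Complex.reCLM Complex.reCLM
  have him_im := hgauss Complex.imCLM Complex.imCLM
  have hZre := memLp_two_sq_of_hasGaussianLaw hre_re.fst
  have hZim := memLp_two_sq_of_hasGaussianLaw him_im.fst
  have hWre := memLp_two_sq_of_hasGaussianLaw hre_re.snd
  have hWim := memLp_two_sq_of_hasGaussianLaw him_im.snd
  have hZre₀ := hZW.fst.integral_re_eq_zero
  have hZim₀ := hZW.fst.integral_im_eq_zero
  have hWre₀ := hZW.snd.integral_re_eq_zero
  have hWim₀ := hZW.snd.integral_im_eq_zero
  have hsq_norm (V : Ω → ℂ) : (fun ω ↦ ‖V ω‖ ^ 2) =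
      (fun ω ↦ Complex.reCLM (V ω) ^ 2) + (fun ω ↦ Complex.imCLM (V ω) ^ 2) := by
    funext ω
    simp only [Pi.add_apply, Complex.reCLM_apply, Complex.imCLM_apply, Complex.sq_norm,
      Complex.normSq_apply]
    ring
  rw [hsq_norm, hsq_norm, covariance_add_left hZre hZim (hWre.add hWim),
    covariance_add_right hZre hWre hWim, covariance_add_right hZim hWre hWim,
    covariance_sq_sq_of_hasGaussianLaw hre_re hZre₀ hWre₀,
    covariance_sq_sq_of_hasGaussianLaw (hgauss _ _) hZre₀ hWim₀,
    covariance_sq_sq_of_hasGaussianLaw (hgauss _ _) hZim₀ hWre₀,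
    covariance_sq_sq_of_hasGaussianLaw him_im hZim₀ hWim₀]
  simp only [Complex.reCLM_apply, Complex.imCLM_apply, hZW.integral_im_mul_im,
    hZW.integral_im_mul_re]
  ring

end Pair

lemma variance_sq_norm (hZ : IsProperGaussian Z P) :
    Var[fun ω ↦ ‖Z ω‖ ^ 2; P] = (∫ ω, ‖Z ω‖ ^ 2 ∂P) ^ 2 := by
  have hZZ : IsProperGaussian (fun ω ↦ (Z ω, Z ω)) P :=
    hZ.map ((ContinuousLinearMap.id ℂ ℂ).prod (.id ℂ ℂ))
  rw [← covariance_self (hZ.hasGaussianLaw.aemeasurable.norm.pow_const 2), hZZ.covariance_sq_norm,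
    hZ.integral_re_mul_im_eq_zero]
  simp only [← sq, hZ.integral_re_sq]
  ring

end IsProperGaussian

end ProperGaussian

section GaussianClosure

variable {Ω T : Type*} [MeasurableSpace Ω] {P : Measure Ω}

lemma hasGaussianLaw_of_forall_re_dual {E : Type*} [NormedAddCommGroup E] [NormedSpace ℝ E]
    [NormedSpace ℂ E] [IsScalarTower ℝ ℂ E] [MeasurableSpace E] [OpensMeasurableSpace E] {Z : Ω → E}
    (hZ : AEMeasurable Z P) (h : ∀ M : StrongDual ℂ E, HasGaussianLaw (fun ω ↦ (M (Z ω)).re) P) :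
    HasGaussianLaw Z P := by
  refine ⟨isGaussian_of_isGaussian_map fun L ↦ ?_⟩
  rw [AEMeasurable.map_map_of_aemeasurable (by fun_prop) hZ]
  have hre : (fun ω ↦ ((StrongDual.extendRCLike L : StrongDual ℂ E) (Z ω)).re) = L ∘ Z :=
    funext fun ω ↦ StrongDual.re_extendRCLike_apply (𝕜 := ℂ) L (Z ω)
  exact hre ▸ (h (StrongDual.extendRCLike L)).isGaussian_map

lemma hasGaussianLaw_coeFn_of_mem_span {X : T → Lp ℝ 2 P} (hX : IsGaussianProcess (fun t ↦ X t) P)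
    {Y : Lp ℝ 2 P} (hY : Y ∈ Submodule.span ℝ (Set.range X)) : HasGaussianLaw Y P := by
  obtain ⟨c, rfl⟩ := (Finsupp.mem_span_range_iff_exists_finsupp).1 hY
  refine ((hX.smul fun t ↦ c t).hasGaussianLaw_fun_sum (I := c.support)).congr ?_
  have hsum : ⇑(c.sum fun i a ↦ a • X i) =ᵐ[P] ∑ t ∈ c.support, ⇑(c t • X t : Lp ℝ 2 P) :=
    Lp.coeFn_finsetSum _ _
  have hsmul : ∀ᵐ ω ∂P, ∀ t ∈ c.support, (c t • X t : Lp ℝ 2 P) ω = c t • X t ω :=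
    (Finset.eventually_all _).2 fun t _ ↦ Lp.coeFn_smul (c t) (X t)
  filter_upwards [hsum, hsmul] with ω hsum hsmul
  rw [hsum, Finset.sum_apply]
  exact (Finset.sum_congr rfl hsmul).symm

lemma inner_toLp_two (Z : Lp ℝ 2 P) {Y : Ω → ℝ} (hY : MemLp Y 2 P) :
    inner ℝ Z (hY.toLp Y) = ∫ ω, Z ω * Y ω ∂P := by
  rw [L2.inner_def]
  refine integral_congr_ae ?_
  filter_upwards [hY.coeFn_toLp] with ω h
  simp [h, mul_comm]

variable [IsProbabilityMeasure P]

lemma continuous_integral_Lp_two : Continuous fun f : Lp ℝ 2 P ↦ ∫ ω, f ω ∂P := by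
  have h : ∀ f : Lp ℝ 2 P, ∫ ω, f ω ∂P =
      inner ℝ (indicatorConstLp 2 MeasurableSet.univ (measure_ne_top P _) (1 : ℝ)) f := fun f ↦ by
    rw [L2.inner_indicatorConstLp_one, setIntegral_univ]
  simp only [h]
  fun_prop

lemma variance_Lp_two (f : Lp ℝ 2 P) : Var[f; P] = ‖f‖ ^ 2 - (∫ ω, f ω ∂P) ^ 2 := by
  rw [variance_eq_sub (Lp.memLp f), ← real_inner_self_eq_norm_sq, L2.inner_def]
  simp [sq]

lemma continuous_variance_Lp_two : Continuous fun f : Lp ℝ 2 P ↦ Var[f; P] := by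
  simp only [variance_Lp_two]
  exact (continuous_norm.pow 2).sub (continuous_integral_Lp_two.pow 2)

lemma tendsto_charFun_map_of_tendsto_Lp_two {f : ℕ → Lp ℝ 2 P} {g : Lp ℝ 2 P}
    (hfg : Tendsto f atTop (𝓝 g)) (t : ℝ) :
    Tendsto (fun n ↦ charFun (P.map (f n)) t) atTop (𝓝 (charFun (P.map g) t)) :=
  ProbabilityMeasure.tendsto_iff_tendsto_charFun.1
    ((tendstoInMeasure_of_tendsto_Lp hfg).tendstoInDistribution
      fun n ↦ (Lp.aestronglyMeasurable (f n)).aemeasurable).tendsto t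

lemma isClosed_setOf_hasGaussianLaw : IsClosed {f : Lp ℝ 2 P | HasGaussianLaw f P} := by
  refine IsSeqClosed.isClosed fun f g hf hfg ↦ ?_
  have hg : AEMeasurable g P := (Lp.aestronglyMeasurable g).aemeasurable
  have hmap : P.map g = gaussianReal (∫ ω, g ω ∂P) Var[g; P].toNNReal := by
    have := Measure.isProbabilityMeasure_map hg
    refine Measure.ext_of_charFun (funext fun t ↦ ?_)
    refine tendsto_nhds_unique (tendsto_charFun_map_of_tendsto_Lp_two hfg t) ?_
    have hmean := (continuous_integral_Lp_two.tendsto g).comp hfg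
    have hvar := (continuous_variance_Lp_two.tendsto g).comp hfg
    simp only [HasGaussianLaw.map_eq_gaussianReal (hf _), charFun_gaussianReal,
      Real.coe_toNNReal _ (variance_nonneg _ _)]
    exact (Complex.continuous_exp.tendsto _).comp
      ((((Complex.continuous_ofReal.tendsto _).comp hmean).const_mul (t : ℂ)).mul_const
        Complex.I |>.sub
        ((((Complex.continuous_ofReal.tendsto _).comp hvar).mul_const ((t : ℂ) ^ 2)).div_const 2))
  exact ⟨hmap ▸ inferInstance⟩

-- `{X t}ᗮᗮ` is the closed span of the `X t` in `L²`.
lemma hasGaussianLaw_of_forall_orthogonal {X : T → Ω → ℝ} (hX : IsGaussianProcess X P)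
    {Y : Ω → ℝ} (hY : MemLp Y 2 P)
    (h : ∀ Z : Lp ℝ 2 P, (∀ t, ∫ ω, Z ω * X t ω ∂P = 0) → ∫ ω, Z ω * Y ω ∂P = 0) :
    HasGaussianLaw Y P := by
  have hX2 t : MemLp (X t) 2 P := (hX.hasGaussianLaw_eval t).memLp_two
  set V : T → Lp ℝ 2 P := fun t ↦ (hX2 t).toLp (X t)
  have hV : IsGaussianProcess (fun t ↦ V t) P := hX.congr fun t ↦ (hX2 t).coeFn_toLp.symm
  have hmem : hY.toLp Y ∈ (Submodule.span ℝ (Set.range V)).topologicalClosure := by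
    rw [← Submodule.orthogonal_orthogonal_eq_closure, Submodule.mem_orthogonal]
    intro Z hZ
    rw [inner_toLp_two]
    refine h Z fun t ↦ ?_
    rw [← inner_toLp_two Z (hX2 t), real_inner_comm]
    exact (Submodule.mem_orthogonal _ _).1 hZ _ (Submodule.subset_span ⟨t, rfl⟩)
  have hspan : (Submodule.span ℝ (Set.range V) : Set (Lp ℝ 2 P)) ⊆ {f | HasGaussianLaw f P} :=
    fun _ ↦ hasGaussianLaw_coeFn_of_mem_span hV
  exact HasGaussianLaw.congr (closure_minimal hspan isClosed_setOf_hasGaussianLaw hmem)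
    hY.coeFn_toLp

end GaussianClosure

section KernelIntegral

variable {Ω S T : Type*} [MeasurableSpace S] [MeasurableSpace T] {μ : Measure T} {ν : Measure S}

/-- The integral of a random process against the kernel `h`, taken path by path. -/
noncomputable def kernelIntegral (Φ : T → Ω → ℝ) (h : T → ℂ) (μ : Measure T) (ω : Ω) : ℂ :=
  ∫ τ, (Φ τ ω : ℂ) * h τ ∂μ

lemma kernelIntegral_mul_kernelIntegral [SFinite μ] [SFinite ν] (Φ : T → Ω → ℝ) (Ψ : S → Ω → ℝ)
    (f : T → ℂ) (g : S → ℂ) (ω : Ω) :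
    kernelIntegral Φ f μ ω * kernelIntegral Ψ g ν ω =
      kernelIntegral (fun z ω ↦ Φ z.1 ω * Ψ z.2 ω) (fun z : T × S ↦ f z.1 * g z.2)
        (μ.prod ν) ω := by
  simp only [kernelIntegral]
  rw [← integral_prod_mul]
  congr 1 with z
  push_cast
  ring

lemma ofReal_mul_kernelIntegral (Z : Ω → ℝ) (Φ : T → Ω → ℝ) (h : T → ℂ) (ω : Ω) :
    (Z ω : ℂ) * kernelIntegral Φ h μ ω =
      kernelIntegral (fun τ ω ↦ Z ω * Φ τ ω) h μ ω := by
  simp only [kernelIntegral, ← integral_const_mul, Complex.ofReal_mul, mul_assoc]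

lemma conj_kernelIntegral (Φ : T → Ω → ℝ) (h : T → ℂ) (ω : Ω) :
    conj (kernelIntegral Φ h μ ω) = kernelIntegral Φ (fun τ ↦ conj (h τ)) μ ω := by
  simp [kernelIntegral, ← integral_conj]

variable [MeasurableSpace Ω] {P : Measure Ω} {q : ℝ≥0∞}

/-- A jointly measurable real process which is bounded in `L^q`. This is what makes the pathwise
integrals of the process against integrable kernels converge. -/
structure IsLpBoundedProcess (Φ : T → Ω → ℝ) (q : ℝ≥0∞) (P : Measure Ω) : Prop where
  measurable : Measurable (Function.uncurry Φ)
  exists_eLpNorm_le : ∃ C : ℝ≥0, ∀ t, eLpNorm (Φ t) q P ≤ C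

namespace IsLpBoundedProcess

variable {Φ Ψ : T → Ω → ℝ}

lemma memLp (hΦ : IsLpBoundedProcess Φ q P) (t : T) : MemLp (Φ t) q P := by
  obtain ⟨C, hC⟩ := hΦ.exists_eLpNorm_le
  exact ⟨hΦ.measurable.of_uncurry_left.aestronglyMeasurable, (hC t).trans_lt ENNReal.coe_lt_top⟩

lemma mono_exponent [IsProbabilityMeasure P] {r : ℝ≥0∞} (hrq : r ≤ q)
    (hΦ : IsLpBoundedProcess Φ q P) : IsLpBoundedProcess Φ r P where
  measurable := hΦ.measurable
  exists_eLpNorm_le := hΦ.exists_eLpNorm_le.imp fun _ hC t ↦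
    (eLpNorm_le_eLpNorm_of_exponent_le hrq (hΦ.memLp t).aestronglyMeasurable).trans (hC t)

lemma const {Z : Ω → ℝ} (hZ : Measurable Z) (hZq : MemLp Z q P) :
    IsLpBoundedProcess (fun _ : T ↦ Z) q P where
  measurable := hZ.comp measurable_snd
  exists_eLpNorm_le := ⟨(eLpNorm Z q P).toNNReal, fun _ ↦
    (ENNReal.coe_toNNReal hZq.eLpNorm_ne_top).ge⟩

lemma comp (hΦ : IsLpBoundedProcess Φ q P) {u : S → T} (hu : Measurable u) :
    IsLpBoundedProcess (fun s ↦ Φ (u s)) q P where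
  measurable := hΦ.measurable.comp (hu.prodMap measurable_id)
  exists_eLpNorm_le := hΦ.exists_eLpNorm_le.imp fun _ hC s ↦ hC (u s)

lemma mul (hΦ : IsLpBoundedProcess Φ 2 P) (hΨ : IsLpBoundedProcess Ψ 2 P) :
    IsLpBoundedProcess (fun t ω ↦ Φ t ω * Ψ t ω) 1 P where
  measurable := hΦ.measurable.mul hΨ.measurable
  exists_eLpNorm_le := by
    obtain ⟨C, hC⟩ := hΦ.exists_eLpNorm_le
    obtain ⟨D, hD⟩ := hΨ.exists_eLpNorm_le
    refine ⟨C * D, fun t ↦ ?_⟩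
    have h := eLpNorm_smul_le_mul_eLpNorm (p := 2) (q := 2) (r := 1)
      (hΨ.memLp t).aestronglyMeasurable (hΦ.memLp t).aestronglyMeasurable
    calc eLpNorm (Φ t • Ψ t) 1 P ≤ eLpNorm (Φ t) 2 P * eLpNorm (Ψ t) 2 P := h
      _ ≤ C * D := by gcongr; exacts [hC t, hD t]
      _ = ↑(C * D) := (ENNReal.coe_mul C D).symm

lemma integrable_prod [SFinite μ] [SFinite P] (hΦ : IsLpBoundedProcess Φ 1 P) {h : T → ℂ}
    (hh : Integrable h μ) :
    Integrable (fun z : T × Ω ↦ (Φ z.1 z.2 : ℂ) * h z.1) (μ.prod P) := by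
  have hm : AEStronglyMeasurable (fun z : T × Ω ↦ (Φ z.1 z.2 : ℂ) * h z.1) (μ.prod P) :=
    (Complex.measurable_ofReal.comp hΦ.measurable).aestronglyMeasurable.mul
      hh.aestronglyMeasurable.comp_fst
  have hint t : Integrable (Φ t) P := memLp_one_iff_integrable.1 (hΦ.memLp t)
  obtain ⟨C, hC⟩ := hΦ.exists_eLpNorm_le
  have hbound t : ∫ ω, ‖Φ t ω‖ ∂P ≤ C := by
    rw [integral_norm_eq_lintegral_enorm (hint t).aestronglyMeasurable,
      ← eLpNorm_one_eq_lintegral_enorm]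
    exact ENNReal.toReal_le_coe_of_le_coe (hC t)
  refine (integrable_prod_iff hm).2 ⟨ae_of_all _ fun t ↦ (hint t).ofReal.mul_const (h t),
    (hh.norm.const_mul (C : ℝ)).mono' hm.norm.integral_prod_right' (ae_of_all _ fun t ↦ ?_)⟩
  rw [Real.norm_of_nonneg (integral_nonneg fun _ ↦ norm_nonneg _)]
  simp only [norm_mul, Complex.norm_real, integral_mul_const]
  gcongr
  exact hbound t

lemma ae_integrable_mul [SFinite μ] [SFinite P] (hΦ : IsLpBoundedProcess Φ 1 P) {h : T → ℂ}
    (hh : Integrable h μ) : ∀ᵐ ω ∂P, Integrable (fun τ ↦ (Φ τ ω : ℂ) * h τ) μ :=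
  (hΦ.integrable_prod hh).prod_left_ae

lemma integrable_kernelIntegral [SFinite μ] [SFinite P] (hΦ : IsLpBoundedProcess Φ 1 P)
    {h : T → ℂ} (hh : Integrable h μ) : Integrable (kernelIntegral Φ h μ) P :=
  (hΦ.integrable_prod hh).integral_prod_right

lemma dual_kernelIntegral_ae_eq {ι : Type*} [Fintype ι] [DecidableEq ι] [SFinite μ] [SFinite P]
    (hΦ : IsLpBoundedProcess Φ 1 P) (M : StrongDual ℂ (ι → ℂ)) {h : ι → T → ℂ}
    (hh : ∀ k, Integrable (h k) μ) :
    (fun ω ↦ M fun k ↦ kernelIntegral Φ (h k) μ ω) =ᵐ[P]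
      kernelIntegral Φ (∑ k, M (Pi.single k 1) • h k) μ := by
  filter_upwards [ae_all_iff.2 fun k ↦ hΦ.ae_integrable_mul (hh k)] with ω hω
  calc M (fun k ↦ kernelIntegral Φ (h k) μ ω)
    _ = ∑ k, M (Pi.single k (kernelIntegral Φ (h k) μ ω)) := by
        rw [← map_sum, Finset.univ_sum_single]
    _ = ∑ k, M (Pi.single k 1) * kernelIntegral Φ (h k) μ ω := by
        congr 1 with k
        rw [mul_comm, ← smul_eq_mul, ← map_smul, ← Pi.single_smul', smul_eq_mul, mul_one]
    _ = kernelIntegral Φ (∑ k, M (Pi.single k 1) • h k) μ ω := by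
        simp only [kernelIntegral, Finset.sum_apply, Pi.smul_apply, smul_eq_mul, Finset.mul_sum,
          ← integral_const_mul, mul_left_comm _ (M _)]
        exact (integral_finsetSum _ fun k _ ↦ (hω k).const_mul (M (Pi.single k 1))).symm

lemma integral_kernelIntegral [SFinite μ] [SFinite P] (hΦ : IsLpBoundedProcess Φ 1 P)
    {h : T → ℂ} (hh : Integrable h μ) :
    ∫ ω, kernelIntegral Φ h μ ω ∂P = ∫ τ, ((∫ ω, Φ τ ω ∂P : ℝ) : ℂ) * h τ ∂μ := by
  simp only [kernelIntegral]
  rw [← integral_integral_swap (f := fun τ ω ↦ (Φ τ ω : ℂ) * h τ) (hΦ.integrable_prod hh)]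
  simp only [integral_mul_const, integral_complex_ofReal]

lemma integrable_kernelIntegral_mul [SFinite μ] [SFinite ν] [SFinite P] {Ψ : S → Ω → ℝ}
    (hΦ : IsLpBoundedProcess Φ 2 P) (hΨ : IsLpBoundedProcess Ψ 2 P) {f : T → ℂ} {g : S → ℂ}
    (hf : Integrable f μ) (hg : Integrable g ν) :
    Integrable (fun ω ↦ kernelIntegral Φ f μ ω * kernelIntegral Ψ g ν ω) P := by
  simp only [kernelIntegral_mul_kernelIntegral]
  exact ((hΦ.comp measurable_fst).mul (hΨ.comp measurable_snd)).integrable_kernelIntegral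
    (hf.mul_prod hg)

lemma integral_kernelIntegral_mul [SFinite μ] [SFinite ν] [SFinite P] {Ψ : S → Ω → ℝ}
    (hΦ : IsLpBoundedProcess Φ 2 P) (hΨ : IsLpBoundedProcess Ψ 2 P) {f : T → ℂ} {g : S → ℂ}
    (hf : Integrable f μ) (hg : Integrable g ν) :
    ∫ ω, kernelIntegral Φ f μ ω * kernelIntegral Ψ g ν ω ∂P =
      ∫ z : T × S, ((∫ ω, Φ z.1 ω * Ψ z.2 ω ∂P : ℝ) : ℂ) * (f z.1 * g z.2) ∂μ.prod ν := by
  simp only [kernelIntegral_mul_kernelIntegral]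
  exact ((hΦ.comp measurable_fst).mul (hΨ.comp measurable_snd)).integral_kernelIntegral
    (hf.mul_prod hg)

variable [SFinite μ] [IsProbabilityMeasure P]

lemma memLp_two_kernelIntegral (hΦ : IsLpBoundedProcess Φ 2 P) {h : T → ℂ}
    (hh : Integrable h μ) : MemLp (kernelIntegral Φ h μ) 2 P := by
  have hm := (hΦ.mono_exponent one_le_two).integrable_kernelIntegral hh
  rw [memLp_two_iff_integrable_sq_norm hm.aestronglyMeasurable]
  simpa [sq] using (hΦ.integrable_kernelIntegral_mul hΦ hh hh).norm

lemma integral_mul_re_kernelIntegral_eq_zero (hΦ : IsLpBoundedProcess Φ 2 P) {Z : Ω → ℝ}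
    (hZ : Measurable Z) (hZ2 : MemLp Z 2 P) (hZΦ : ∀ τ, ∫ ω, Z ω * Φ τ ω ∂P = 0) {h : T → ℂ}
    (hh : Integrable h μ) : ∫ ω, Z ω * (kernelIntegral Φ h μ ω).re ∂P = 0 := by
  have hK : Integrable (fun ω ↦ (Z ω : ℂ) * kernelIntegral Φ h μ ω) P :=
    hZ2.ofReal.integrable_mul (hΦ.memLp_two_kernelIntegral hh)
  have hzero : ∫ ω, (Z ω : ℂ) * kernelIntegral Φ h μ ω ∂P = 0 := by
    simp only [ofReal_mul_kernelIntegral]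
    rw [((const hZ hZ2).mul hΦ).integral_kernelIntegral hh]
    simp [hZΦ]
  simpa [hzero] using integral_re hK

lemma hasGaussianLaw_re_kernelIntegral (hΦ : IsLpBoundedProcess Φ 2 P)
    (hG : IsGaussianProcess Φ P) {h : T → ℂ} (hh : Integrable h μ) :
    HasGaussianLaw (fun ω ↦ (kernelIntegral Φ h μ ω).re) P :=
  hasGaussianLaw_of_forall_orthogonal hG (hΦ.memLp_two_kernelIntegral hh).re fun Z hZΦ ↦
    hΦ.integral_mul_re_kernelIntegral_eq_zero (Lp.stronglyMeasurable Z).measurable (Lp.memLp Z)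
      hZΦ hh

end IsLpBoundedProcess

end KernelIntegral

section FourierUniqueness

open scoped FourierTransform SchwartzMap

variable {V E : Type*} [NormedAddCommGroup V] [InnerProductSpace ℝ V] [FiniteDimensional ℝ V]
  [MeasurableSpace V] [BorelSpace V] [NormedAddCommGroup E] [NormedSpace ℂ E] [CompleteSpace E]
  {f : V → E}

lemma integral_schwartzMap_smul_eq_zero (hf : Integrable f) (h : 𝓕 f = 0) (g : 𝓢(V, ℂ)) :
    ∫ x, g x • f x = 0 := by
  obtain ⟨φ, rfl⟩ : ∃ φ : 𝓢(V, ℂ), 𝓕 φ = g := ⟨𝓕⁻ g, FourierTransform.fourier_fourierInv_eq g⟩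
  calc ∫ x, (𝓕 φ) x • f x = ∫ x, φ x • 𝓕 f x := by
        rw [SchwartzMap.fourier_coe]
        simpa only [flip_innerₗ] using! VectorFourier.integral_fourierIntegral_smul_eq_flip
          (L := innerₗ V) (μ := volume) (ν := volume) Real.continuous_fourierChar
          continuous_inner φ.integrable hf
    _ = 0 := by simp [h]

lemma ae_eq_zero_of_fourier_eq_zero (hf : Integrable f) (h : 𝓕 f = 0) : f =ᵐ[volume] 0 := by
  refine ae_eq_zero_of_integral_contDiff_smul_eq_zero hf.locallyIntegrable fun g hg hgc ↦ ?_
  have hg' : ContDiff ℝ ((⊤ : ℕ∞) : WithTop ℕ∞) (Complex.ofReal ∘ g) :=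
    Complex.ofRealCLM.contDiff.comp hg
  have hgc' : HasCompactSupport (Complex.ofReal ∘ g) := hgc.comp_left rfl
  simpa using integral_schwartzMap_smul_eq_zero hf h (hgc'.toSchwartzMap hg')

end FourierUniqueness

section AngularFourier

variable {f g ψ : ℝ → ℂ}

open scoped FourierTransform in
lemma angularFourier_eq_fourier (f : ℝ → ℂ) (ω : ℝ) :
    angularFourier f ω = 𝓕 f (ω / (2 * Real.pi)) := by
  rw [Real.fourier_real_eq_integral_exp_smul, angularFourier]
  congr 1 with t
  rw [smul_eq_mul]
  congr 2
  push_cast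
  field_simp

lemma norm_cexp_neg_I_mul_mul (t ω : ℝ) : ‖Complex.exp (-(Complex.I * t * ω))‖ = 1 := by
  simp [Complex.norm_exp]

lemma integrable_cexp_neg_I_mul_mul {μ : Measure ℝ} (hf : Integrable f μ) (ω : ℝ) :
    Integrable (fun t : ℝ ↦ Complex.exp (-(Complex.I * t * ω)) * f t) μ :=
  hf.bdd_mul (by fun_prop) (ae_of_all _ fun t ↦ (norm_cexp_neg_I_mul_mul t ω).le)

lemma angularFourier_zero_right (f : ℝ → ℂ) : angularFourier f 0 = ∫ t, f t := by
  simp [angularFourier]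

lemma angularFourier_sub (hf : Integrable f) (hg : Integrable g) (ω : ℝ) :
    angularFourier (f - g) ω = angularFourier f ω - angularFourier g ω := by
  simp only [angularFourier, Pi.sub_apply, mul_sub]
  exact integral_sub (integrable_cexp_neg_I_mul_mul hf ω) (integrable_cexp_neg_I_mul_mul hg ω)

lemma angularFourier_sum_smul {ι : Type*} (s : Finset ι) (c : ι → ℂ) {f : ι → ℝ → ℂ}
    (hf : ∀ k ∈ s, Integrable (f k)) (ω : ℝ) :
    angularFourier (∑ k ∈ s, c k • f k) ω = ∑ k ∈ s, c k * angularFourier (f k) ω := by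
  simp only [angularFourier, Finset.sum_apply, Pi.smul_apply, smul_eq_mul, Finset.mul_sum,
    mul_left_comm _ (c _), ← integral_const_mul]
  exact integral_finsetSum _ fun k hk ↦ (integrable_cexp_neg_I_mul_mul (hf k hk) ω).const_mul _

lemma angularFourier_conj (f : ℝ → ℂ) (ω : ℝ) :
    angularFourier (fun t ↦ conj (f t)) ω = conj (angularFourier f (-ω)) := by
  simp only [angularFourier, ← integral_conj, map_mul, ← Complex.exp_conj]
  simp

lemma angularFourier_comp_sub_div (f : ℝ → ℂ) (t : ℝ) {s : ℝ} (hs : 0 < s) (ω : ℝ) :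
    angularFourier (fun τ ↦ f ((τ - t) / s)) ω =
      s * (Complex.exp (-(Complex.I * t * ω)) * angularFourier f (s * ω)) := by
  set G : ℝ → ℂ := fun u ↦ Complex.exp (-(Complex.I * u * (s * ω : ℝ))) * f u with hG
  have hs' : (s : ℂ) ≠ 0 := by exact_mod_cast hs.ne'
  have hintegrand (τ : ℝ) : Complex.exp (-(Complex.I * τ * ω)) * f ((τ - t) / s) =
      Complex.exp (-(Complex.I * t * ω)) * G ((τ - t) / s) := by
    rw [hG, ← mul_assoc, ← Complex.exp_add]
    congr 2
    push_cast
    field_simp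
    ring
  calc angularFourier (fun τ ↦ f ((τ - t) / s)) ω
    _ = Complex.exp (-(Complex.I * t * ω)) * ∫ τ, G ((τ - t) / s) := by
        simp only [angularFourier, hintegrand, integral_const_mul]
    _ = Complex.exp (-(Complex.I * t * ω)) * (s * ∫ u, G u) := by
        rw [integral_sub_right_eq_self (fun τ ↦ G (τ / s)) t, Measure.integral_comp_div,
          abs_of_pos hs, Complex.real_smul]
    _ = s * (Complex.exp (-(Complex.I * t * ω)) * angularFourier f (s * ω)) := mul_left_comm _ _ _

lemma norm_angularFourier_le (f : ℝ → ℂ) (ω : ℝ) : ‖angularFourier f ω‖ ≤ ∫ t, ‖f t‖ :=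
  (norm_integral_le_integral_norm _).trans_eq (by simp only [norm_mul, norm_cexp_neg_I_mul_mul,
    one_mul])

lemma continuous_angularFourier (hf : Integrable f) : Continuous (angularFourier f) :=
  continuous_of_dominated (fun ω ↦ (integrable_cexp_neg_I_mul_mul hf ω).aestronglyMeasurable)
    (fun ω ↦ ae_of_all _ fun t ↦ by rw [norm_mul, norm_cexp_neg_I_mul_mul, one_mul]) hf.norm
    (ae_of_all _ fun t ↦ by fun_prop)

lemma ae_eq_zero_of_angularFourier_eq_zero (hf : Integrable f) (h : ∀ ω, angularFourier f ω = 0) :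
    f =ᵐ[volume] 0 := by
  refine ae_eq_zero_of_fourier_eq_zero hf (funext fun ξ ↦ ?_)
  rw [← mul_div_cancel_left₀ ξ Real.two_pi_pos.ne', ← angularFourier_eq_fourier, h, Pi.zero_apply]

lemma angularFourier_eq_angularFourier_zero_of_dilation (hf : Integrable f) {r : ℝ} (hr0 : 0 ≤ r)
    (hr1 : r < 1) (h : ∀ ω, angularFourier f (r * ω) = angularFourier f ω) (ω : ℝ) :
    angularFourier f ω = angularFourier f 0 := by
  have hpow (n : ℕ) : angularFourier f (r ^ n * ω) = angularFourier f ω := by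
    induction n with
    | zero => simp
    | succ n ih => rw [pow_succ', mul_assoc, h, ih]
  have hlim : Tendsto (fun n : ℕ ↦ angularFourier f (r ^ n * ω)) atTop
      (𝓝 (angularFourier f 0)) := by
    refine ((continuous_angularFourier hf).tendsto 0).comp ?_
    simpa using (tendsto_pow_atTop_nhds_zero_of_lt_one hr0 hr1).mul_const ω
  simp only [hpow] at hlim
  exact tendsto_nhds_unique tendsto_const_nhds hlim

lemma ae_eq_zero_of_angularFourier_dilation_eq (hf : Integrable f) (hf0 : angularFourier f 0 = 0)
    {s₁ s₂ : ℝ} (h₁ : 0 < s₁) (h₂ : 0 < s₂) (hne : s₁ ≠ s₂)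
    (h : ∀ ξ, angularFourier f (s₁ * ξ) = angularFourier f (s₂ * ξ)) : f =ᵐ[volume] 0 := by
  wlog hlt : s₁ < s₂ generalizing s₁ s₂
  · exact this h₂ h₁ hne.symm (fun ξ ↦ (h ξ).symm) (hne.lt_or_gt.resolve_left hlt)
  refine ae_eq_zero_of_angularFourier_eq_zero hf fun ω ↦ ?_
  rw [← hf0]
  refine angularFourier_eq_angularFourier_zero_of_dilation hf (div_pos h₁ h₂).le
    ((div_lt_one h₂).2 hlt) (fun ω ↦ ?_) ω
  rw [div_mul_eq_mul_div, ← mul_div_assoc', h, mul_div_cancel₀ _ h₂.ne']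

end AngularFourier

section WideSenseStationary

variable {Ω : Type*} [MeasurableSpace Ω] {P : Measure Ω} {Φ : ℝ → Ω → ℝ} {ν : Measure ℝ}
  {f g h : ℝ → ℂ}

lemma integral_charFun_sub_mul [IsFiniteMeasure ν] (hf : Integrable f) (hg : Integrable g) :
    ∫ z : ℝ × ℝ, charFun ν (z.1 - z.2) * (f z.1 * g z.2) ∂volume.prod volume =
      ∫ ξ, angularFourier f (-ξ) * angularFourier g ξ ∂ν := by
  have hint : Integrable (fun w : (ℝ × ℝ) × ℝ ↦
      Complex.exp ((w.1.1 - w.1.2 : ℝ) * w.2 * Complex.I) * (f w.1.1 * g w.1.2))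
      ((volume.prod volume).prod ν) :=
    ((hf.mul_prod hg).comp_fst ν).bdd_mul (c := 1) (by fun_prop)
      (ae_of_all _ fun w ↦ by simp [Complex.norm_exp])
  simp only [charFun_apply_real, ← integral_mul_const]
  rw [integral_integral_swap (f := fun (z : ℝ × ℝ) (ξ : ℝ) ↦
    Complex.exp ((z.1 - z.2 : ℝ) * ξ * Complex.I) * (f z.1 * g z.2)) hint]
  congr 1 with ξ
  simp only [angularFourier]
  rw [← integral_prod_mul]
  congr 1 with z
  rw [mul_mul_mul_comm, ← Complex.exp_add]
  congr 2
  push_cast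
  ring

/-- A jointly measurable real process with finite second moments and constant mean whose covariance
is stationary, with spectral measure `ν`: `cov (Φ s, Φ t) = ∫ e^{i (s - t) ξ} ∂ν ξ`. -/
structure IsWideSenseStationary (Φ : ℝ → Ω → ℝ) (P : Measure Ω) (ν : Measure ℝ) : Prop where
  measurable : Measurable (Function.uncurry Φ)
  memLp_two (t : ℝ) : MemLp (Φ t) 2 P
  integral_eq (s t : ℝ) : ∫ ω, Φ s ω ∂P = ∫ ω, Φ t ω ∂P
  covariance_eq (s t : ℝ) : ((cov[Φ s, Φ t; P] : ℝ) : ℂ) = charFun ν (s - t)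

namespace IsWideSenseStationary

variable [IsProbabilityMeasure P]

lemma integral_mul (hΦ : IsWideSenseStationary Φ P ν) (s t : ℝ) :
    ((∫ ω, Φ s ω * Φ t ω ∂P : ℝ) : ℂ) =
      charFun ν (s - t) + ((∫ ω, Φ 0 ω ∂P : ℝ) : ℂ) ^ 2 := by
  rw [← hΦ.covariance_eq, covariance_eq_sub (hΦ.memLp_two s) (hΦ.memLp_two t),
    hΦ.integral_eq s 0, hΦ.integral_eq t 0]
  push_cast [Pi.mul_apply]
  ring

lemma isLpBoundedProcess (hΦ : IsWideSenseStationary Φ P ν) : IsLpBoundedProcess Φ 2 P where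
  measurable := hΦ.measurable
  exists_eLpNorm_le := by
    have hsq (t : ℝ) : ∫ ω, Φ t ω ^ 2 ∂P = ∫ ω, Φ 0 ω ^ 2 ∂P := by
      simp only [sq]
      rw [← Complex.ofReal_inj, hΦ.integral_mul, hΦ.integral_mul, sub_self, sub_self]
    refine ⟨(eLpNorm (Φ 0) 2 P).toNNReal, fun t ↦ ?_⟩
    rw [ENNReal.coe_toNNReal (hΦ.memLp_two 0).eLpNorm_ne_top,
      (hΦ.memLp_two t).eLpNorm_eq_integral_rpow_norm two_ne_zero ENNReal.ofNat_ne_top,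
      (hΦ.memLp_two 0).eLpNorm_eq_integral_rpow_norm two_ne_zero ENNReal.ofNat_ne_top]
    simp [hsq]

lemma integral_kernelIntegral_eq_zero (hΦ : IsWideSenseStationary Φ P ν) (hf : Integrable f)
    (hf0 : angularFourier f 0 = 0) : ∫ ω, kernelIntegral Φ f volume ω ∂P = 0 := by
  rw [(hΦ.isLpBoundedProcess.mono_exponent one_le_two).integral_kernelIntegral hf]
  simp only [hΦ.integral_eq _ 0]
  rw [integral_const_mul, ← angularFourier_zero_right, hf0, mul_zero]

variable [IsFiniteMeasure ν]

theorem integral_kernelIntegral_mul (hΦ : IsWideSenseStationary Φ P ν) (hf : Integrable f)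
    (hg : Integrable g) :
    ∫ ω, kernelIntegral Φ f volume ω * kernelIntegral Φ g volume ω ∂P =
      ∫ ξ, angularFourier f (-ξ) * angularFourier g ξ ∂ν +
        ((∫ ω, Φ 0 ω ∂P : ℝ) : ℂ) ^ 2 * (angularFourier f 0 * angularFourier g 0) := by
  have hfg := hf.mul_prod hg
  have hcov : Integrable (fun z : ℝ × ℝ ↦ charFun ν (z.1 - z.2) * (f z.1 * g z.2))
      (volume.prod volume) :=
    hfg.bdd_mul (c := ν.real Set.univ) (by fun_prop) (ae_of_all _ fun z ↦ norm_charFun_le _)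
  rw [hΦ.isLpBoundedProcess.integral_kernelIntegral_mul hΦ.isLpBoundedProcess hf hg]
  simp only [hΦ.integral_mul, add_mul]
  rw [integral_add hcov (hfg.const_mul _), integral_charFun_sub_mul hf hg, integral_const_mul,
    integral_prod_mul, angularFourier_zero_right, angularFourier_zero_right]

lemma integral_kernelIntegral_mul_of_angularFourier_zero (hΦ : IsWideSenseStationary Φ P ν)
    (hf : Integrable f) (hf0 : angularFourier f 0 = 0) (hg : Integrable g) :
    ∫ ω, kernelIntegral Φ f volume ω * kernelIntegral Φ g volume ω ∂P =
      ∫ ξ, angularFourier f (-ξ) * angularFourier g ξ ∂ν := by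
  simp [hΦ.integral_kernelIntegral_mul hf hg, hf0]

lemma integral_sq_norm_kernelIntegral (hΦ : IsWideSenseStationary Φ P ν) (hh : Integrable h)
    (hh0 : angularFourier h 0 = 0) :
    ∫ ω, ‖kernelIntegral Φ h volume ω‖ ^ 2 ∂P = ∫ ξ, ‖angularFourier h (-ξ)‖ ^ 2 ∂ν := by
  have hconj : Integrable fun τ ↦ conj (h τ) :=
    (LinearIsometryEquiv.integrable_comp_iff Complex.conjLIE).2 hh
  have key := hΦ.integral_kernelIntegral_mul_of_angularFourier_zero hh hh0 hconj
  simp only [angularFourier_conj, ← conj_kernelIntegral, Complex.mul_conj,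
    Complex.normSq_eq_norm_sq, integral_complex_ofReal] at key
  exact_mod_cast key

end IsWideSenseStationary

end WideSenseStationary

section AntianalyticKernel

/-- An integrable kernel whose Fourier transform vanishes on `[0, ∞)`. -/
structure IsAntianalyticKernel (h : ℝ → ℂ) : Prop where
  integrable : Integrable h
  antianalytic : ∀ ω : ℝ, 0 ≤ ω → angularFourier h ω = 0

namespace IsAntianalyticKernel

variable {f g : ℝ → ℂ}

lemma sum_smul {ι : Type*} (s : Finset ι) (c : ι → ℂ) {h : ι → ℝ → ℂ}
    (hh : ∀ k ∈ s, IsAntianalyticKernel (h k)) : IsAntianalyticKernel (∑ k ∈ s, c k • h k) where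
  integrable := integrable_finsetSum' _ fun k hk ↦ (hh k hk).integrable.smul (c k)
  antianalytic ω hω := by
    rw [angularFourier_sum_smul s c fun k hk ↦ (hh k hk).integrable]
    exact Finset.sum_eq_zero fun k hk ↦ by rw [(hh k hk).antianalytic ω hω, mul_zero]

lemma angularFourier_neg_mul (hf : IsAntianalyticKernel f) (hg : IsAntianalyticKernel g) (ξ : ℝ) :
    angularFourier f (-ξ) * angularFourier g ξ = 0 := by
  obtain hξ | hξ := le_total 0 ξ
  · rw [hg.antianalytic ξ hξ, mul_zero]
  · rw [hf.antianalytic (-ξ) (neg_nonneg.2 hξ), zero_mul]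

end IsAntianalyticKernel

variable {Ω : Type*} [MeasurableSpace Ω] {P : Measure Ω} [IsProbabilityMeasure P]
  {Φ : ℝ → Ω → ℝ} {ν : Measure ℝ} [IsFiniteMeasure ν] {f g : ℝ → ℂ}

namespace IsWideSenseStationary

lemma integral_kernelIntegral_sq_eq_zero (hΦ : IsWideSenseStationary Φ P ν)
    (hf : IsAntianalyticKernel f) : ∫ ω, kernelIntegral Φ f volume ω ^ 2 ∂P = 0 := by
  simp only [sq]
  rw [hΦ.integral_kernelIntegral_mul_of_angularFourier_zero hf.integrable
    (hf.antianalytic 0 le_rfl) hf.integrable]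
  simp only [hf.angularFourier_neg_mul hf, integral_zero]

theorem isProperGaussian_kernelIntegral (hΦ : IsWideSenseStationary Φ P ν)
    (hG : IsGaussianProcess Φ P) {ι : Type*} [Fintype ι] {h : ι → ℝ → ℂ}
    (hh : ∀ k, IsAntianalyticKernel (h k)) :
    IsProperGaussian (fun ω k ↦ kernelIntegral Φ (h k) volume ω) P := by
  classical
  have hΦ₁ := hΦ.isLpBoundedProcess.mono_exponent one_le_two
  have hint k := (hh k).integrable
  have hcomb (M : StrongDual ℂ (ι → ℂ)) :=
    IsAntianalyticKernel.sum_smul Finset.univ (fun k ↦ M (Pi.single k 1)) fun k _ ↦ hh k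
  refine ⟨hasGaussianLaw_of_forall_re_dual (aemeasurable_pi_lambda _ fun k ↦
    (hΦ₁.integrable_kernelIntegral (hint k)).aemeasurable) fun M ↦ ?_, fun M ↦ ?_, fun M ↦ ?_⟩
  · refine (hΦ.isLpBoundedProcess.hasGaussianLaw_re_kernelIntegral hG (hcomb M).integrable).congr ?_
    filter_upwards [hΦ₁.dual_kernelIntegral_ae_eq M hint] with ω hω
    exact congrArg Complex.re hω.symm
  · rw [integral_congr_ae (hΦ₁.dual_kernelIntegral_ae_eq M hint),
      hΦ.integral_kernelIntegral_eq_zero (hcomb M).integrable ((hcomb M).antianalytic 0 le_rfl)]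
  · rw [← hΦ.integral_kernelIntegral_sq_eq_zero (hcomb M)]
    refine integral_congr_ae ?_
    filter_upwards [hΦ₁.dual_kernelIntegral_ae_eq M hint] with ω hω using congrArg (· ^ 2) hω

lemma isProperGaussian_kernelIntegral_prodMk (hΦ : IsWideSenseStationary Φ P ν)
    (hG : IsGaussianProcess Φ P) (hf : IsAntianalyticKernel f) (hg : IsAntianalyticKernel g) :
    IsProperGaussian (fun ω ↦ (kernelIntegral Φ f volume ω, kernelIntegral Φ g volume ω)) P :=
  (hΦ.isProperGaussian_kernelIntegral hG (h := ![f, g])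
    (by simpa [Fin.forall_fin_two] using ⟨hf, hg⟩)).map
    ((ContinuousLinearMap.proj 0).prod (ContinuousLinearMap.proj 1))

end IsWideSenseStationary

end AntianalyticKernel

section WaveletTransform

/-- The kernel against which the wavelet transform at time `t` and scale `s` integrates. -/
noncomputable def waveletKernel (ψ : ℝ → ℂ) (t s τ : ℝ) : ℂ :=
  ((1 / s : ℝ) : ℂ) * conj (ψ ((τ - t) / s))

variable {ψ : ℝ → ℂ} {s s₁ s₂ : ℝ}

lemma integrable_waveletKernel (hψ : Integrable ψ) (t : ℝ) (hs : 0 < s) :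
    Integrable (waveletKernel ψ t s) :=
  ((LinearIsometryEquiv.integrable_comp_iff Complex.conjLIE).2
    ((hψ.comp_div hs.ne').comp_sub_right t)).const_mul _

lemma angularFourier_waveletKernel (ψ : ℝ → ℂ) (t : ℝ) (hs : 0 < s) (ω : ℝ) :
    angularFourier (waveletKernel ψ t s) ω =
      Complex.exp (-(Complex.I * t * ω)) * conj (angularFourier ψ (-(s * ω))) := by
  have hs' : (s : ℂ) ≠ 0 := by exact_mod_cast hs.ne'
  rw [← angularFourier_conj, ← mul_right_inj' hs',
    ← angularFourier_comp_sub_div (fun τ ↦ conj (ψ τ)) t hs]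
  simp only [angularFourier, waveletKernel, ← integral_const_mul]
  congr 1 with τ
  push_cast
  field_simp

lemma isAntianalyticKernel_waveletKernel (hψ : Integrable ψ)
    (hψ₀ : ∀ ω ≤ 0, angularFourier ψ ω = 0) (t : ℝ) (hs : 0 < s) :
    IsAntianalyticKernel (waveletKernel ψ t s) where
  integrable := integrable_waveletKernel hψ t hs
  antianalytic ω hω := by
    rw [angularFourier_waveletKernel ψ t hs, hψ₀ _ (neg_nonpos.2 (mul_nonneg hs.le hω)), map_zero,
      mul_zero]

lemma integral_sq_norm_angularFourier_dilation_sub_pos {ν : Measure ℝ} [IsFiniteMeasure ν]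
    [ν.IsOpenPosMeasure] (hψ : Integrable ψ) (hψ₀ : angularFourier ψ 0 = 0)
    (hψ_ne : ¬ ψ =ᵐ[volume] 0) (h₁ : 0 < s₁) (h₂ : 0 < s₂) (hne : s₁ ≠ s₂) :
    0 < ∫ ξ, ‖angularFourier ψ (s₁ * ξ) - angularFourier ψ (s₂ * ξ)‖ ^ 2 ∂ν := by
  have hcont : Continuous fun ξ ↦ ‖angularFourier ψ (s₁ * ξ) - angularFourier ψ (s₂ * ξ)‖ ^ 2 := by
    have := continuous_angularFourier hψ
    fun_prop
  have hint : Integrable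
      (fun ξ ↦ ‖angularFourier ψ (s₁ * ξ) - angularFourier ψ (s₂ * ξ)‖ ^ 2) ν := by
    refine .of_bound hcont.aestronglyMeasurable (((∫ t, ‖ψ t‖) + ∫ t, ‖ψ t‖) ^ 2)
      (ae_of_all _ fun ξ ↦ ?_)
    rw [norm_pow, norm_norm]
    gcongr
    exact (norm_sub_le _ _).trans
      (add_le_add (norm_angularFourier_le ψ _) (norm_angularFourier_le ψ _))
  obtain ⟨ξ, hξ⟩ : ∃ ξ, angularFourier ψ (s₁ * ξ) ≠ angularFourier ψ (s₂ * ξ) := by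
    contrapose! hψ_ne
    exact ae_eq_zero_of_angularFourier_dilation_eq hψ hψ₀ h₁ h₂ hne hψ_ne
  exact integral_pos_of_integrable_nonneg_nonzero hcont hint (fun _ ↦ by positivity)
    (pow_ne_zero 2 (norm_ne_zero_iff.2 (sub_ne_zero.2 hξ)))

lemma noiseAWT_eq_kernelIntegral {Ω : Type*} (ψ : ℝ → ℂ) (Φ : ℝ → Ω → ℝ) (t s : ℝ) :
    noiseAWT ψ Φ t s = kernelIntegral Φ (waveletKernel ψ t s) volume :=
  rfl

variable {Ω : Type*} [MeasurableSpace Ω] {P : Measure Ω} {Φ : ℝ → Ω → ℝ}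

lemma sq_canonicalDist (ψ : ℝ → ℂ) (Φ : ℝ → Ω → ℝ) (P : Measure Ω) (s₁ s₂ : ℝ) :
    canonicalDist ψ Φ P s₁ s₂ ^ 2 =
      ∫ ω, ‖noiseAWT ψ Φ 0 s₁ ω - noiseAWT ψ Φ 0 s₂ ω‖ ^ 2 ∂P :=
  Real.sq_sqrt (integral_nonneg fun _ ↦ by positivity)

namespace IsWideSenseStationary

variable {ν : Measure ℝ} [IsProbabilityMeasure P]

lemma ae_integrable_waveletIntegrand (hΦ : IsWideSenseStationary Φ P ν) (hψ : Integrable ψ)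
    (t : ℝ) (hs : 0 < s) :
    ∀ᵐ ω ∂P, Integrable fun τ ↦ waveletIntegrand ψ (fun u ↦ Φ u ω) t s τ :=
  (hΦ.isLpBoundedProcess.mono_exponent one_le_two).ae_integrable_mul
    (integrable_waveletKernel hψ t hs)

lemma noiseAWT_sub_ae_eq (hΦ : IsWideSenseStationary Φ P ν) (hψ : Integrable ψ) (t : ℝ)
    (h₁ : 0 < s₁) (h₂ : 0 < s₂) :
    (fun ω ↦ noiseAWT ψ Φ t s₁ ω - noiseAWT ψ Φ t s₂ ω) =ᵐ[P]
      kernelIntegral Φ (waveletKernel ψ t s₁ - waveletKernel ψ t s₂) volume := by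
  filter_upwards [hΦ.ae_integrable_waveletIntegrand hψ t h₁,
    hΦ.ae_integrable_waveletIntegrand hψ t h₂] with ω hω₁ hω₂
  simp only [noiseAWT_eq_kernelIntegral, kernelIntegral, Pi.sub_apply, mul_sub]
  exact (integral_sub hω₁ hω₂).symm

variable [IsFiniteMeasure ν]

lemma integral_sq_norm_noiseAWT_sub (hΦ : IsWideSenseStationary Φ P ν) (hψ : Integrable ψ)
    (hψ₀ : angularFourier ψ 0 = 0) (t : ℝ) (h₁ : 0 < s₁) (h₂ : 0 < s₂) :
    ∫ ω, ‖noiseAWT ψ Φ t s₁ ω - noiseAWT ψ Φ t s₂ ω‖ ^ 2 ∂P =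
      ∫ ξ, ‖angularFourier ψ (s₁ * ξ) - angularFourier ψ (s₂ * ξ)‖ ^ 2 ∂ν := by
  have hk₁ := integrable_waveletKernel hψ t h₁
  have hk₂ := integrable_waveletKernel hψ t h₂
  have hfourier (ξ : ℝ) : angularFourier (waveletKernel ψ t s₁ - waveletKernel ψ t s₂) (-ξ) =
      Complex.exp (-(Complex.I * t * (-ξ : ℝ))) *
        conj (angularFourier ψ (s₁ * ξ) - angularFourier ψ (s₂ * ξ)) := by
    rw [angularFourier_sub hk₁ hk₂, angularFourier_waveletKernel ψ t h₁,
      angularFourier_waveletKernel ψ t h₂, ← mul_sub, ← map_sub]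
    simp only [mul_neg, neg_neg]
  calc ∫ ω, ‖noiseAWT ψ Φ t s₁ ω - noiseAWT ψ Φ t s₂ ω‖ ^ 2 ∂P
    _ = ∫ ω, ‖kernelIntegral Φ (waveletKernel ψ t s₁ - waveletKernel ψ t s₂) volume ω‖ ^ 2 ∂P :=
        integral_congr_ae ((hΦ.noiseAWT_sub_ae_eq hψ t h₁ h₂).fun_comp (‖·‖ ^ 2))
    _ = ∫ ξ, ‖angularFourier (waveletKernel ψ t s₁ - waveletKernel ψ t s₂) (-ξ)‖ ^ 2 ∂ν :=
        hΦ.integral_sq_norm_kernelIntegral (hk₁.sub hk₂) (by simpa [hψ₀] using hfourier 0)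
    _ = ∫ ξ, ‖angularFourier ψ (s₁ * ξ) - angularFourier ψ (s₂ * ξ)‖ ^ 2 ∂ν := by
        simp only [hfourier, norm_mul, norm_cexp_neg_I_mul_mul, one_mul, RCLike.norm_conj]

lemma canonicalDist_pos [ν.IsOpenPosMeasure] (hΦ : IsWideSenseStationary Φ P ν)
    (hψ : Integrable ψ) (hψ₀ : angularFourier ψ 0 = 0) (hψ_ne : ¬ ψ =ᵐ[volume] 0) (h₁ : 0 < s₁)
    (h₂ : 0 < s₂) (hne : s₁ ≠ s₂) : 0 < canonicalDist ψ Φ P s₁ s₂ := by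
  rw [canonicalDist, Real.sqrt_pos, hΦ.integral_sq_norm_noiseAWT_sub hψ hψ₀ 0 h₁ h₂]
  exact integral_sq_norm_angularFourier_dilation_sub_pos hψ hψ₀ hψ_ne h₁ h₂ hne

lemma isProperGaussian_noiseAWT (hΦ : IsWideSenseStationary Φ P ν) (hG : IsGaussianProcess Φ P)
    (hψ : Integrable ψ) (hψ₀ : ∀ ω ≤ 0, angularFourier ψ ω = 0) {ι : Type*} [Fintype ι]
    (t : ι → ℝ) {s : ι → ℝ} (hs : ∀ k, 0 < s k) :
    IsProperGaussian (fun ω k ↦ noiseAWT ψ Φ (t k) (s k) ω) P := by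
  simp only [noiseAWT_eq_kernelIntegral]
  exact hΦ.isProperGaussian_kernelIntegral hG
    fun k ↦ isAntianalyticKernel_waveletKernel hψ hψ₀ (t k) (hs k)

lemma isProperGaussian_noiseAWT_prodMk (hΦ : IsWideSenseStationary Φ P ν)
    (hG : IsGaussianProcess Φ P) (hψ : Integrable ψ) (hψ₀ : ∀ ω ≤ 0, angularFourier ψ ω = 0)
    (t₁ t₂ : ℝ) (h₁ : 0 < s₁) (h₂ : 0 < s₂) :
    IsProperGaussian (fun ω ↦ (noiseAWT ψ Φ t₁ s₁ ω, noiseAWT ψ Φ t₂ s₂ ω)) P := by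
  simp only [noiseAWT_eq_kernelIntegral]
  exact hΦ.isProperGaussian_kernelIntegral_prodMk hG
    (isAntianalyticKernel_waveletKernel hψ hψ₀ t₁ h₁)
    (isAntianalyticKernel_waveletKernel hψ hψ₀ t₂ h₂)

lemma hasLaw_sq_norm_noiseAWT_sub [ν.IsOpenPosMeasure] (hΦ : IsWideSenseStationary Φ P ν)
    (hG : IsGaussianProcess Φ P) (hψ : Integrable ψ) (hψ₀ : ∀ ω ≤ 0, angularFourier ψ ω = 0)
    (hψ_ne : ¬ ψ =ᵐ[volume] 0) (t : ℝ) (h₁ : 0 < s₁) (h₂ : 0 < s₂) (hne : s₁ ≠ s₂) :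
    HasLaw (fun ω ↦ ‖noiseAWT ψ Φ t s₁ ω - noiseAWT ψ Φ t s₂ ω‖ ^ 2 /
      canonicalDist ψ Φ P s₁ s₂ ^ 2) (expMeasure 1) P := by
  have hψ₀' := hψ₀ 0 le_rfl
  have hmoment := hΦ.integral_sq_norm_noiseAWT_sub hψ hψ₀' t h₁ h₂
  have hpos := integral_sq_norm_angularFourier_dilation_sub_pos (ν := ν) hψ hψ₀' hψ_ne h₁ h₂ hne
  rw [sq_canonicalDist, hΦ.integral_sq_norm_noiseAWT_sub hψ hψ₀' 0 h₁ h₂, ← hmoment]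
  exact (hΦ.isProperGaussian_noiseAWT_prodMk hG hψ hψ₀ t t h₁ h₂).sub.hasLaw_sq_norm_div
    (hmoment ▸ hpos)

end IsWideSenseStationary

end WaveletTransform

section SpectralDensity

variable {Ω : Type*} [MeasurableSpace Ω] {P : Measure Ω} {Φ : ℝ → Ω → ℝ} {p : ℝ → ℝ}

lemma charFun_withDensity_ofReal (hp : Integrable p) (hp₀ : ∀ ξ, 0 ≤ p ξ) (t : ℝ) :
    charFun (volume.withDensity fun ξ ↦ ENNReal.ofReal (p ξ)) t =
      ∫ ξ : ℝ, Complex.exp (Complex.I * t * ξ) * (p ξ : ℂ) := by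
  rw [charFun_apply_real, integral_withDensity_eq_integral_toReal_smul₀
    hp.1.aemeasurable.ennreal_ofReal (ae_of_all _ fun _ ↦ ENNReal.ofReal_lt_top)]
  congr 1 with ξ
  rw [ENNReal.toReal_ofReal (hp₀ ξ), Complex.real_smul, mul_comm]
  congr 2
  ring

lemma isOpenPosMeasure_withDensity_ofReal (hp : AEMeasurable p) (hp₀ : ∀ ξ, 0 < p ξ) :
    (volume.withDensity fun ξ ↦ ENNReal.ofReal (p ξ)).IsOpenPosMeasure :=
  (withDensity_absolutelyContinuous' hp.ennreal_ofReal
    (ae_of_all _ fun ξ ↦ (ENNReal.ofReal_pos.2 (hp₀ ξ)).ne')).isOpenPosMeasure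

namespace IsStationaryProcess

lemma integral_eval_eq (hΦ : IsStationaryProcess Φ P) (t : ℝ) :
    ∫ ω, Φ t ω ∂P = ∫ ω, Φ 0 ω ∂P := by
  simpa [Function.comp_def] using
    ((hΦ t).comp (u := fun x : ℝ → ℝ ↦ x 0) (measurable_pi_apply 0)).integral_eq

lemma integral_mul_eval_eq (hΦ : IsStationaryProcess Φ P) (s t : ℝ) :
    ∫ ω, Φ s ω * Φ t ω ∂P = ∫ ω, Φ (s - t) ω * Φ 0 ω ∂P := by
  simpa [Function.comp_def] using
    ((hΦ t).comp (u := fun x : ℝ → ℝ ↦ x (s - t) * x 0) (by fun_prop)).integral_eq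

lemma covariance_eval_eq [IsProbabilityMeasure P] (hΦ : IsStationaryProcess Φ P)
    (hΦ₂ : ∀ t, MemLp (Φ t) 2 P) (s t : ℝ) : cov[Φ s, Φ t; P] = cov[Φ (s - t), Φ 0; P] := by
  rw [covariance_eq_sub (hΦ₂ s) (hΦ₂ t), covariance_eq_sub (hΦ₂ (s - t)) (hΦ₂ 0),
    hΦ.integral_eval_eq s, hΦ.integral_eval_eq t, hΦ.integral_eval_eq (s - t)]
  simp only [Pi.mul_apply, hΦ.integral_mul_eval_eq s t]

end IsStationaryProcess

lemma IsStationaryGaussianNoise.isWideSenseStationary [IsProbabilityMeasure P]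
    (hΦ : IsStationaryGaussianNoise Φ P p) :
    IsWideSenseStationary Φ P (volume.withDensity fun ξ ↦ ENNReal.ofReal (p ξ)) := by
  have hΦ₂ (t : ℝ) : MemLp (Φ t) 2 P := (hΦ.gaussian.hasGaussianLaw_eval t).memLp_two
  refine ⟨hΦ.measurable, hΦ₂, fun s t ↦ ?_, fun s t ↦ ?_⟩
  · rw [hΦ.stationary.integral_eval_eq s, hΦ.stationary.integral_eval_eq t]
  · rw [hΦ.stationary.covariance_eval_eq hΦ₂, hΦ.covariance_eq,
      charFun_withDensity_ofReal hΦ.density_integrable fun ξ ↦ (hΦ.density_pos ξ).le]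

end SpectralDensity

theorem mainTheorem7_general {Ω : Type*} [MeasurableSpace Ω] (P : Measure Ω)
    [IsProbabilityMeasure P] (Φ : ℝ → Ω → ℝ) (ν : Measure ℝ) [IsFiniteMeasure ν]
    (hΦ : IsWideSenseStationary Φ P ν) (hG : IsGaussianProcess Φ P)
    (ψ : ℝ → ℂ) (hψ : Integrable ψ) (hψ₀ : ∀ ω ≤ 0, angularFourier ψ ω = 0) :
    (∀ t s : ℝ, 0 < s →
      ∀ᵐ ω ∂P, Integrable (fun τ ↦ waveletIntegrand ψ (fun u ↦ Φ u ω) t s τ)) ∧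
    (∀ (d : ℕ) (t s : Fin d → ℝ), (∀ k, 0 < s k) →
      HasGaussianLaw (fun ω k ↦ noiseAWT ψ Φ (t k) (s k) ω) P ∧
      IsCircularlySymmetric (fun ω k ↦ noiseAWT ψ Φ (t k) (s k) ω) P) ∧
    (ν.IsOpenPosMeasure → ¬ ψ =ᵐ[volume] 0 → ∀ t s₁ s₂ : ℝ, 0 < s₁ → 0 < s₂ → s₁ ≠ s₂ →
      0 < canonicalDist ψ Φ P s₁ s₂ ∧
      HasLaw (fun ω ↦ ‖noiseAWT ψ Φ t s₁ ω - noiseAWT ψ Φ t s₂ ω‖ ^ 2 /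
        canonicalDist ψ Φ P s₁ s₂ ^ 2) (expMeasure 1) P) ∧
    (∀ t₁ t₂ s₁ s₂ : ℝ, 0 < s₁ → 0 < s₂ →
      cov[noiseScalogram ψ Φ t₁ s₁, noiseScalogram ψ Φ t₂ s₂; P] =
        4 * (∫ ω, (noiseAWT ψ Φ t₁ s₁ ω).re * (noiseAWT ψ Φ t₂ s₂ ω).re ∂P) ^ 2 +
        4 * (∫ ω, (noiseAWT ψ Φ t₁ s₁ ω).re * (noiseAWT ψ Φ t₂ s₂ ω).im ∂P) ^ 2) ∧
    (∀ t s : ℝ, 0 < s →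
      Var[noiseScalogram ψ Φ t s; P] = 4 * (∫ ω, (noiseAWT ψ Φ t s ω).re ^ 2 ∂P) ^ 2 ∧
      Var[noiseScalogram ψ Φ t s; P] = (∫ ω, noiseScalogram ψ Φ t s ω ∂P) ^ 2) := by
  refine ⟨fun t s hs ↦ hΦ.ae_integrable_waveletIntegrand hψ t hs, fun d t s hs ↦ ?_,
    fun hν hψ_ne t s₁ s₂ h₁ h₂ hne ↦ ?_, fun t₁ t₂ s₁ s₂ h₁ h₂ ↦ ?_, fun t s hs ↦ ?_⟩
  · have hW := hΦ.isProperGaussian_noiseAWT hG hψ hψ₀ t hs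
    exact ⟨hW.hasGaussianLaw, fun θ ↦ hW.identDistrib_smul (by simp [Complex.norm_exp])⟩
  · exact ⟨hΦ.canonicalDist_pos hψ (hψ₀ 0 le_rfl) hψ_ne h₁ h₂ hne,
      hΦ.hasLaw_sq_norm_noiseAWT_sub hG hψ hψ₀ hψ_ne t h₁ h₂ hne⟩
  · exact (hΦ.isProperGaussian_noiseAWT_prodMk hG hψ hψ₀ t₁ t₂ h₁ h₂).covariance_sq_norm
  · have hW := (hΦ.isProperGaussian_noiseAWT_prodMk hG hψ hψ₀ t t hs hs).fst
    have hvar : Var[noiseScalogram ψ Φ t s; P] = (∫ ω, noiseScalogram ψ Φ t s ω ∂P) ^ 2 :=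
      hW.variance_sq_norm
    have hre : ∫ ω, (noiseAWT ψ Φ t s ω).re ^ 2 ∂P = (∫ ω, noiseScalogram ψ Φ t s ω ∂P) / 2 :=
      hW.integral_re_sq
    exact ⟨by rw [hvar, hre]; ring, hvar⟩

theorem mainTheorem7 {Ω : Type*} [MeasurableSpace Ω] (P : Measure Ω) [IsProbabilityMeasure P]
    (Φ : ℝ → Ω → ℝ) (p : ℝ → ℝ) (hΦ : IsStationaryGaussianNoise Φ P p)
    (ψ : ℝ → ℂ) (hψ : IsAnalyticWavelet ψ) :
    -- the defining integral of `W_Φ(t, s)` converges absolutely almost surely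
    (∀ t s : ℝ, 0 < s →
      ∀ᵐ ω ∂P, Integrable (fun τ ↦ waveletIntegrand ψ (fun u ↦ Φ u ω) t s τ)) ∧
    -- (a)
    (∀ (t : ℝ) (d : ℕ) (s : Fin d → ℝ), (∀ k, 0 < s k) →
      HasGaussianLaw (fun ω k ↦ noiseAWT ψ Φ t (s k) ω) P ∧
      IsCircularlySymmetric (fun ω k ↦ noiseAWT ψ Φ t (s k) ω) P) ∧
    -- (b)
    (¬ ψ =ᵐ[volume] 0 → ∀ t s₁ s₂ : ℝ, 0 < s₁ → 0 < s₂ → s₁ ≠ s₂ →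
      0 < canonicalDist ψ Φ P s₁ s₂ ∧
      HasLaw (fun ω ↦ ‖noiseAWT ψ Φ t s₁ ω - noiseAWT ψ Φ t s₂ ω‖ ^ 2 /
        canonicalDist ψ Φ P s₁ s₂ ^ 2) (expMeasure 1) P) ∧
    -- (c)
    (∀ t s₁ s₂ : ℝ, 0 < s₁ → 0 < s₂ →
      cov[noiseScalogram ψ Φ t s₁, noiseScalogram ψ Φ t s₂; P] =
          4 * (∫ ω, (noiseAWT ψ Φ t s₁ ω).re * (noiseAWT ψ Φ t s₂ ω).re ∂P) ^ 2 +
          4 * (∫ ω, (noiseAWT ψ Φ t s₁ ω).re * (noiseAWT ψ Φ t s₂ ω).im ∂P) ^ 2 ∧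
      0 ≤ cov[noiseScalogram ψ Φ t s₁, noiseScalogram ψ Φ t s₂; P]) ∧
    (∀ t s : ℝ, 0 < s →
      Var[noiseScalogram ψ Φ t s; P] =
          4 * (∫ ω, |(noiseAWT ψ Φ t s ω).re| ^ 2 ∂P) ^ 2 ∧
      Var[noiseScalogram ψ Φ t s; P] = (∫ ω, noiseScalogram ψ Φ t s ω ∂P) ^ 2) := by
  have hν := isOpenPosMeasure_withDensity_ofReal hΦ.density_integrable.1.aemeasurable hΦ.density_pos
  have : IsFiniteMeasure (volume.withDensity fun ξ ↦ ENNReal.ofReal (p ξ)) :=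
    isFiniteMeasure_withDensity_ofReal hΦ.density_integrable.2
  obtain ⟨hconv, hgauss, hexp, hcov, hvar⟩ := mainTheorem7_general P Φ _ hΦ.isWideSenseStationary
    hΦ.gaussian ψ hψ.integrable hψ.analytic
  refine ⟨hconv, fun t d ↦ hgauss d fun _ ↦ t, hexp hν, fun t s₁ s₂ h₁ h₂ ↦ ?_, ?_⟩
  · have hcov_eq := hcov t t s₁ s₂ h₁ h₂
    exact ⟨hcov_eq, hcov_eq ▸ by positivity⟩
  · simpa only [sq_abs] using hvar
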